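/- For a positive integer $v$, let $K_v$ be the complete graph on the vertex set $\{0,1,\dots,v-1\}$, and let the linear length of the edge joining $i$ and $j$ be $|j-i|$. A linear realization of a multiset $L$ of positive integers is a Hamiltonian path in $K_v$, where $v=|L|+1$, whose multiset of linear edge lengths is exactly $L$. Let $x,y$ be integers with $1<x<y$, let $a,b,c\ge 0$ be integers with $a+b\ge y-1$, and let $L=\{1^a,x^b,y^c\}$ be the multiset containing $1$, $x$ and $y$ with multiplicities $a$, $b$ and $c$ respectively. Then $L$ has a linear realization in each of the following cases: 1. $x$ is even and $a\ge x+y-2$; 2. $x$ is odd, and either $y$ is even and $a\ge x+y-1$, or $y$ is odd and $a\ge x+y$; 3. $y=x+1$ and $a\ge x+1$; 4. $x$ is even, $y\ge 2x+1$, $a\ge 3x-2$ and $a+b\ge x+y-1$; 5. $x=2$, $y\ge 5$ and $a\ge 3$. -/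

import Mathlib

/-- The linear length `|j - i|` of the edge between the vertices labelled `i` and `j`. -/
def linearLength {v : ℕ} : Sym2 (Fin v) → ℕ :=
  Sym2.lift ⟨fun i j => Nat.dist i j, fun i j => Nat.dist_comm i j⟩

/-- The walk `p` in the complete graph on the vertices `0, …, v - 1` is a linear realization of the
multiset `L`: it is a Hamiltonian path, and the multiset of linear lengths of its edges is `L`. -/
def IsLinearRealization {v : ℕ} {s t : Fin v} (p : (⊤ : SimpleGraph (Fin v)).Walk s t)
    (L : Multiset ℕ) : Prop :=
  p.IsHamiltonian ∧ (p.edges : Multiset (Sym2 (Fin v))).map linearLength = L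

/-- The multiset `L` has a linear realization, that is, one in the complete graph on the vertices
`0, …, v - 1` for some `v`; such a path has `v - 1` edges, so necessarily `v = |L| + 1`. -/
def HasLinearRealization (L : Multiset ℕ) : Prop :=
  ∃ (v : ℕ) (s t : Fin v) (p : (⊤ : SimpleGraph (Fin v)).Walk s t), IsLinearRealization p L

/-- The multiset `{1^a, x^b, y^c}`, exponents being multiplicities. -/
def lengthMultiset (a x b y c : ℕ) : Multiset ℕ :=
  Multiset.replicate a 1 + Multiset.replicate b x + Multiset.replicate c y

/-!
A Hamiltonian path of `K_v` is handled as a list of the numbers `0, …, v - 1`, its edge lengths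
being the `gaps` of the list. A path starting at `0` is called *standard*; two standard paths can
be glued at `0` (`Standard.join`), and a standard path can be extended by edges of length `1`. So
it is enough to construct standard paths with few ones, and, where gluing would cost too many ones,
a single path for the whole multiset. There are two kinds of constructions.

*Growing a path* (`Config`). If `p`, `p + 1` are neighbours on a path on `0, …, v - 1` and
`v = p + x`, then `p, p + 1` can be replaced by `p, v, v + 1, p + 1`: two more edges of length `x`, and
again a pair of neighbours `v`, `v + 1`. When `x` is even and the last `x` vertices are paired up
in this way, the step can be repeated indefinitely (`Config.pairs`). When `x` is odd, one vertex of
each block of `x` remains unpaired; it is appended at the end of the path, which gives the rows of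
`Config.rowsX`. A few other steps correct the parities: reversing the final part of a path
(`Config.rotate` and its special cases) and, for `y = x + 1`, insertions that add edges of both
lengths (`Config.single`, `Config.triple`). They settle the two-length multisets
(`standard_of_even`, `standard_of_odd`), from which the case of odd `x` follows by gluing, the case
`y = x + 1` up to multisets with a single edge of length `x`, and most multisets with `x` even, at
least `y` ones and `c % y > x`, where `c` is the number of edges of length `y`.

*Weaving columns* (`weave`). On `(n + 1) * y + r` vertices, `r < y`, the residue classes modulo `y`
form `r` tall and `y - r` short columns. Going up and down the columns in the order of a path on
the residues costs the gaps of that path, at the top as well as at the bottom (`gaps_weave`),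
except that a change at the top between a tall column `j` and a short column `k` costs the distance
between `j + y` and `k`. So two-length paths on the residues yield three-length paths. The edges of
length `x` they lack are supplied either by gluing, or by growing the path at a place where the
vertices `0, 1, …` are neighbours in pairs: reflection moves such a place to the top end of the
path (`exists_config_ring`).
-/

/-! ### Gaps of a list of vertices -/

/-- The multiset of distances between consecutive entries of a list of natural numbers. -/
def gaps : List ℕ → Multiset ℕ
  | p :: q :: t => Nat.dist p q ::ₘ gaps (q :: t)
  | _ => 0

@[simp] theorem gaps_nil : gaps [] = 0 := rfl

@[simp] theorem gaps_singleton (p : ℕ) : gaps [p] = 0 := rfl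

@[simp] theorem gaps_cons_cons (p q : ℕ) (t : List ℕ) :
    gaps (p :: q :: t) = {Nat.dist p q} + gaps (q :: t) := rfl

/-- Two lists overlapping in one vertex: the gaps of the union are the gaps of both. -/
theorem gaps_append_cons (s t : List ℕ) (p : ℕ) :
    gaps (s ++ p :: t) = gaps (s ++ [p]) + gaps (p :: t) := by
  induction s with
  | nil => simp
  | cons a s ih =>
    cases s with
    | nil => simp
    | cons b s => simpa [add_assoc] using ih

theorem gaps_append_cons_cons (s t : List ℕ) (p q : ℕ) :
    gaps (s ++ p :: q :: t) = gaps (s ++ [p]) + {Nat.dist p q} + gaps (q :: t) := by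
  rw [gaps_append_cons, gaps_cons_cons, add_assoc]

theorem gaps_reverse (l : List ℕ) : gaps l.reverse = gaps l := by
  induction l with
  | nil => rfl
  | cons p l ih =>
    cases l with
    | nil => rfl
    | cons q t =>
      have h : (p :: q :: t).reverse = t.reverse ++ q :: [p] := by simp
      rw [h, gaps_append_cons, gaps_cons_cons p q, ← ih, Nat.dist_comm]
      simp [add_comm]

theorem gaps_map (f : ℕ → ℕ) (l : List ℕ)
    (hf : ∀ p ∈ l, ∀ q ∈ l, Nat.dist (f p) (f q) = Nat.dist p q) :
    gaps (l.map f) = gaps l := by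
  induction l with
  | nil => rfl
  | cons p l ih =>
    cases l with
    | nil => rfl
    | cons q t =>
      simp only [List.map_cons, gaps_cons_cons] at ih ⊢
      rw [ih (fun a ha b hb => hf a (List.mem_cons_of_mem _ ha) b (List.mem_cons_of_mem _ hb)),
        hf p (by simp) q (by simp)]

theorem pair_infix_append (s t : List ℕ) (p q : ℕ) :
    [p, q] <:+: s ++ t ↔
      [p, q] <:+: s ∨ [p, q] <:+: t ∨ (s.getLast? = some p ∧ t.head? = some q) := by
  induction s with
  | nil => simp
  | cons a s ih =>
    rw [List.cons_append, List.infix_cons_iff, ih, List.infix_cons_iff]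
    cases s with
    | nil => 
      cases t with
      | nil => simp
      | cons b t =>
        simp only [List.nil_append, List.cons_prefix_cons, List.nil_prefix, and_true,
          List.getLast?_singleton, Option.some.injEq, List.head?_cons, List.getLast?_nil,
          List.infix_nil, List.prefix_nil]
        simp
        constructor
        · rintro (⟨rfl, rfl⟩ | h)
          · simp
          · simp [h]
        · rintro (h | ⟨rfl, rfl⟩)
          · simp [h]
          · simp
    | cons b s => simp [List.cons_prefix_cons]; tauto

theorem pair_infix_reverse (l : List ℕ) (p q : ℕ) : [p, q] <:+: l.reverse ↔ [q, p] <:+: l := by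
  rw [← List.reverse_infix]; simp

theorem exists_of_pair_infix {l : List ℕ} {p q : ℕ} (h : [p, q] <:+: l) :
    ∃ s t, l = s ++ p :: q :: t := by
  obtain ⟨s, t, rfl⟩ := h
  exact ⟨s, t, by simp⟩

/-- `Nb true l p q`: the vertex `q` comes directly after `p` in `l`.
`Nb false l p q`: the vertices `p` and `q` are neighbours in `l`, in either order. -/
def Nb (d : Bool) (l : List ℕ) (p q : ℕ) : Prop :=
  [p, q] <:+: l ∨ d = false ∧ [q, p] <:+: l

theorem Nb.mono {d : Bool} {l l' : List ℕ} {p q : ℕ} (h : Nb d l p q) (hl : l <:+: l') :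
    Nb d l' p q :=
  h.imp (fun h => h.trans hl) fun h => ⟨h.1, h.2.trans hl⟩

/-- The block `m` is inserted between two neighbours `p`, `q`; it is read from `p` to `q`, whichever
of the two comes first in `l`. -/
theorem exists_insert {d : Bool} {l : List ℕ} {p q : ℕ} (h : Nb d l p q) (m : List ℕ) :
    ∃ l', l'.Perm (m ++ l) ∧
      gaps l' + {Nat.dist p q} = gaps l + gaps (p :: (m ++ [q])) ∧
      l'.head? = l.head? ∧ l'.getLast? = l.getLast? ∧
      (∀ r s, Nb d l r s → ¬(r = p ∧ s = q) → ¬(r = q ∧ s = p) → Nb d l' r s) ∧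
      ∀ r s, Nb d (p :: (m ++ [q])) r s → Nb d l' r s := by
  have key : ∀ {p q : ℕ} (m : List ℕ), [p, q] <:+: l → ∃ l', l'.Perm (m ++ l) ∧
      gaps l' + {Nat.dist p q} = gaps l + gaps (p :: (m ++ [q])) ∧
      l'.head? = l.head? ∧ l'.getLast? = l.getLast? ∧
      (∀ r s, [r, s] <:+: l → ¬(r = p ∧ s = q) → [r, s] <:+: l') ∧ (p :: (m ++ [q])) <:+: l' := by
    intro p q m h
    obtain ⟨s, t, rfl⟩ := exists_of_pair_infix h
    refine ⟨s ++ p :: (m ++ q :: t), ?_, ?_, ?_, ?_, ?_, ⟨s, t, by simp⟩⟩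
    · rw [List.perm_iff_count]; intro a; simp [List.count_cons]; omega
    · rw [gaps_append_cons_cons, gaps_append_cons s, ← List.cons_append, gaps_append_cons (p :: m)]
      simp only [List.cons_append]; abel
    · cases s <;> simp
    · rw [List.getLast?_append, List.getLast?_append, ← List.cons_append,
        List.getLast?_append_of_ne_nil _ (by simp), List.getLast?_cons_cons]
    · intro r u hr hne
      have e1 : s ++ p :: q :: t = (s ++ [p]) ++ (q :: t) := by simp
      have e2 : s ++ p :: (m ++ q :: t) = ((s ++ [p]) ++ m) ++ (q :: t) := by simp
      rw [e1, pair_infix_append] at hr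
      rw [e2, pair_infix_append, pair_infix_append]
      rcases hr with hr | hr | hr
      · tauto
      · tauto
      · simp at hr; exact absurd ⟨hr.1.symm, hr.2.symm⟩ hne
  rcases h with h | ⟨rfl, h⟩
  · obtain ⟨l', h1, h2, h3, h4, h5, h6⟩ := key m h
    refine ⟨l', h1, h2, h3, h4, ?_, fun r s hr => hr.mono h6⟩
    rintro r s (hr | ⟨hd, hr⟩) n1 n2
    · exact Or.inl (h5 _ _ hr n1)
    · exact Or.inr ⟨hd, h5 _ _ hr (by tauto)⟩
  · obtain ⟨l', h1, h2, h3, h4, h5, h6⟩ := key m.reverse h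
    have e : q :: (m.reverse ++ [p]) = (p :: (m ++ [q])).reverse := by simp
    refine ⟨l', h1.trans ((List.reverse_perm m).append_right l), ?_, h3, h4, ?_, ?_⟩
    · rw [e, gaps_reverse, Nat.dist_comm] at h2; exact h2
    · rintro r s (hr | ⟨hd, hr⟩) n1 n2
      · exact Or.inl (h5 _ _ hr (by tauto))
      · exact Or.inr ⟨hd, h5 _ _ hr (by tauto)⟩
    · rw [e] at h6
      rintro r s (hr | ⟨hd, hr⟩)
      · exact Or.inr ⟨rfl, ((pair_infix_reverse _ _ _).2 hr).trans h6⟩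
      · exact Or.inl (((pair_infix_reverse _ _ _).2 hr).trans h6)

/-- Cutting a path between `q` and its successor `q'`, and running the part after the cut backwards,
with the block `m` traversed between `q` and the former last vertex `u`. -/
theorem exists_rotate {l : List ℕ} {q q' u : ℕ} (h : [q, q'] <:+: l) (hu : l.getLast? = some u)
    (m : List ℕ) :
    ∃ l', l'.Perm (m ++ l) ∧
      gaps l' + {Nat.dist q q'} = gaps l + gaps (q :: (m ++ [u])) ∧
      l'.head? = l.head? ∧ l'.getLast? = some q' ∧
      (∀ r s, [r, s] <:+: l → ¬(r = q ∧ s = q') → Nb false l' r s) ∧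
      ∀ r s, Nb false (q :: (m ++ [u])) r s → Nb false l' r s := by
  obtain ⟨s, t, rfl⟩ := exists_of_pair_infix h
  obtain ⟨t', ht⟩ : ∃ t', (q' :: t).reverse = u :: t' := by
    have : ((q' :: t).reverse).head? = some u := by
      rw [List.head?_reverse]; simpa using hu
    cases hh : (q' :: t).reverse with
    | nil => simp [hh] at this
    | cons a b => rw [hh] at this; simp at this; exact ⟨b, by rw [this]⟩
  refine ⟨s ++ q :: (m ++ (q' :: t).reverse), ?_, ?_, ?_, ?_, ?_, ?_⟩
  · rw [List.perm_iff_count]; intro a; simp [List.count_cons]; omega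
  · have : gaps (q' :: t) = gaps (u :: t') := by rw [← ht, gaps_reverse]
    rw [gaps_append_cons_cons, this, ht, gaps_append_cons s, ← List.cons_append,
      gaps_append_cons (q :: m)]
    simp only [List.cons_append]; abel
  · cases s <;> simp
  · rw [List.getLast?_append, ← List.cons_append, List.getLast?_append, List.getLast?_reverse]
    simp
  · intro r w hr hne
    have e1 : s ++ q :: q' :: t = (s ++ [q]) ++ (q' :: t) := by simp
    have e2 : s ++ q :: (m ++ (q' :: t).reverse) = ((s ++ [q]) ++ m) ++ (q' :: t).reverse := by simp
    rw [e1, pair_infix_append] at hr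
    rw [e2]
    unfold Nb
    rw [pair_infix_append, pair_infix_append, pair_infix_append ((s ++ [q]) ++ m),
      pair_infix_reverse, pair_infix_reverse]
    rcases hr with hr | hr | hr
    · tauto
    · tauto
    · simp at hr; exact absurd ⟨hr.1.symm, hr.2.symm⟩ hne
  · intro r w hr
    refine hr.mono ⟨s, t', ?_⟩
    rw [ht]; simp

theorem exists_append {d : Bool} {l : List ℕ} {e : ℕ} (he : l.getLast? = some e) (m : List ℕ) :
    ∃ l', l'.Perm (m ++ l) ∧ gaps l' = gaps l + gaps (e :: m) ∧ l'.head? = l.head? ∧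
      l'.getLast? = (e :: m).getLast? ∧ (∀ r s, Nb d l r s → Nb d l' r s) ∧
      ∀ r s, Nb d (e :: m) r s → Nb d l' r s := by
  obtain ⟨s, rfl⟩ : ∃ s, l = s ++ [e] := by
    rw [List.getLast?_eq_some_iff] at he; exact he
  refine ⟨s ++ e :: m, ?_, ?_, ?_, ?_, fun r w h => h.mono ⟨[], m, by simp⟩,
    fun r w h => h.mono ⟨s, [], by simp⟩⟩
  · rw [List.perm_iff_count]; intro a; simp [List.count_cons]; omega
  · rw [gaps_append_cons]
  · cases s <;> simp
  · rw [List.getLast?_append_of_ne_nil _ (by simp)]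

/-! ### Paths as lists of vertices -/

theorem map_linearLength_edges_ofSupport {v : ℕ} (l : List (Fin v)) (hne : l ≠ [])
    (hc : l.IsChain (⊤ : SimpleGraph (Fin v)).Adj) :
    ((SimpleGraph.Walk.ofSupport l hne hc).edges : Multiset (Sym2 (Fin v))).map linearLength =
      gaps (l.map Fin.val) := by
  induction l with
  | nil => exact absurd rfl hne
  | cons i l ih =>
    cases l with
    | nil => simp
    | cons j t =>
      have := ih (List.cons_ne_nil _ _) hc.of_cons
      change Multiset.map linearLength (s(i, j) ::ₘ
        ((SimpleGraph.Walk.ofSupport (j :: t) (List.cons_ne_nil _ _) hc.of_cons).edges :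
          Multiset (Sym2 (Fin v)))) = _
      rw [Multiset.map_cons, this]
      rfl

theorem hasLinearRealization_of_perm {l : List ℕ} {v : ℕ} (hv : 0 < v)
    (hl : l.Perm (List.range v)) : HasLinearRealization (gaps l) := by
  have hlt : ∀ p ∈ l, p < v := fun p hp => List.mem_range.1 (hl.mem_iff.1 hp)
  obtain ⟨f, hf⟩ : ∃ f : List (Fin v), f.map Fin.val = l :=
    ⟨l.pmap Fin.mk hlt, by simp [List.map_pmap]⟩
  have hnd : f.Nodup := by
    apply List.Nodup.of_map Fin.val
    rw [hf]; exact hl.nodup_iff.2 List.nodup_range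
  have hmem : ∀ i : Fin v, i ∈ f := by
    intro i
    have : (i : ℕ) ∈ f.map Fin.val := by rw [hf, hl.mem_iff]; simp
    obtain ⟨j, hj, hji⟩ := List.mem_map.1 this
    rwa [← Fin.ext hji]
  have hne : f ≠ [] := List.ne_nil_of_mem (hmem ⟨0, hv⟩)
  have hc : f.IsChain (⊤ : SimpleGraph (Fin v)).Adj :=
    (List.Pairwise.isChain hnd).imp fun i j h => by simpa using h
  refine ⟨v, _, _, SimpleGraph.Walk.ofSupport f hne hc, ?_, ?_⟩
  · apply SimpleGraph.Walk.IsPath.isHamiltonian_of_mem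
    · rw [SimpleGraph.Walk.isPath_def, SimpleGraph.Walk.support_ofSupport]; exact hnd
    · intro w; rw [SimpleGraph.Walk.support_ofSupport]; exact hmem w
  · rw [map_linearLength_edges_ofSupport, hf]

theorem lengthMultiset_add (x y a b c a' b' c' : ℕ) :
    lengthMultiset a x b y c + lengthMultiset a' x b' y c' =
      lengthMultiset (a + a') x (b + b') y (c + c') := by
  simp only [lengthMultiset, Multiset.replicate_add]; abel

theorem lengthMultiset_swap (x y a b c : ℕ) :
    lengthMultiset a x b y c = lengthMultiset a y c x b := by
  simp only [lengthMultiset]; abel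

theorem singleton_one_eq (x y : ℕ) : ({1} : Multiset ℕ) = lengthMultiset 1 x 0 y 0 := rfl

theorem singleton_left_eq (x y : ℕ) : ({x} : Multiset ℕ) = lengthMultiset 0 x 1 y 0 := rfl

theorem singleton_right_eq (x y : ℕ) : ({y} : Multiset ℕ) = lengthMultiset 0 x 0 y 1 := rfl

theorem dist_of_add_eq {p q d : ℕ} (h : p + d = q) : Nat.dist p q = d := by
  unfold Nat.dist; omega

theorem dist_of_add_eq' {p q d : ℕ} (h : q + d = p) : Nat.dist p q = d := by
  unfold Nat.dist; omega

/-- The multiset `{1^a, x^b, y^c}` has a *standard* realization: one that starts at `0`. -/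
def Standard (x y a b c : ℕ) : Prop :=
  ∃ l : List ℕ, l.Perm (List.range (a + b + c + 1)) ∧ gaps l = lengthMultiset a x b y c ∧
    l.head? = some 0

theorem Standard.hasLinearRealization {x y a b c : ℕ} (h : Standard x y a b c) :
    HasLinearRealization (lengthMultiset a x b y c) := by
  obtain ⟨l, h1, h2, -⟩ := h
  exact h2 ▸ hasLinearRealization_of_perm (Nat.succ_pos _) h1

theorem Standard.swap {x y a b c : ℕ} (h : Standard x y a b c) : Standard y x a c b := by
  obtain ⟨l, h1, h2, h3⟩ := h
  exact ⟨l, by rwa [add_right_comm a c b], by rw [h2, lengthMultiset_swap], h3⟩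

theorem perm_map_add_append {l l' : List ℕ} {m n : ℕ} (hl : l.Perm (List.range m))
    (hl' : l'.Perm (List.range n)) : (l ++ l'.map (m + ·)).Perm (List.range (m + n)) := by
  rw [List.range_add]; exact hl.append (hl'.map _)

/-- A new vertex is put in front of the path. -/
theorem Standard.add_one {x y a b c : ℕ} (h : Standard x y a b c) : Standard x y (a + 1) b c := by
  obtain ⟨l, h1, h2, h3⟩ := h
  obtain ⟨t, rfl⟩ : ∃ t, l = 0 :: t := by
    cases l with
    | nil => simp at h3
    | cons p t => simp at h3; exact ⟨t, by rw [h3]⟩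
  refine ⟨[0] ++ (0 :: t).map (1 + ·), ?_, ?_, rfl⟩
  · have := perm_map_add_append (l := [0]) (m := 1) (by simp) h1
    convert this using 2; omega
  · have : gaps ((0 :: t).map (1 + ·)) = lengthMultiset a x b y c := by
      rw [gaps_map _ _ (fun p _ q _ => by unfold Nat.dist; omega), h2]
    simp only [List.map_cons, List.cons_append, List.nil_append, gaps_cons_cons] at this ⊢
    rw [this, dist_of_add_eq (d := 1) (by omega), singleton_one_eq x y, lengthMultiset_add]
    congr 1 <;> omega

theorem Standard.mono {x y a b c a' : ℕ} (h : Standard x y a b c) (ha : a ≤ a') :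
    Standard x y a' b c := by
  induction a', ha using Nat.le_induction with
  | base => exact h
  | succ n _ ih => exact ih.add_one

theorem perm_reflect {l : List ℕ} {v : ℕ} (hl : l.Perm (List.range v)) :
    (l.map (v - 1 - ·)).Perm (List.range v) := by
  refine (hl.map _).trans ?_
  have : (List.range v).reverse = (List.range v).map (v - 1 - ·) := by
    apply List.ext_getElem <;> simp
  rw [← this]; exact List.reverse_perm _

theorem gaps_reflect {l : List ℕ} {v : ℕ} (hl : ∀ p ∈ l, p < v) :
    gaps (l.map (v - 1 - ·)) = gaps l :=
  gaps_map _ _ fun p hp q hq => by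
    have := hl p hp
    have := hl q hq
    unfold Nat.dist; omega

/-- Two standard realizations are glued at their vertex `0`, one of them being reflected. -/
theorem Standard.join {x y a b c a' b' c' : ℕ} (h : Standard x y a b c)
    (h' : Standard x y a' b' c') :
    HasLinearRealization (lengthMultiset (a + a') x (b + b') y (c + c')) := by
  obtain ⟨l, h1, h2, h3⟩ := h
  obtain ⟨l', h1', h2', h3'⟩ := h'
  obtain ⟨t, rfl⟩ : ∃ t, l = 0 :: t := by
    cases l with
    | nil => simp at h3
    | cons p t => simp at h3; exact ⟨t, by rw [h3]⟩
  obtain ⟨t', rfl⟩ : ∃ t, l' = 0 :: t := by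
    cases l' with
    | nil => simp at h3'
    | cons p t => simp at h3'; exact ⟨t, by rw [h3']⟩
  set v := a + b + c with hv
  have hp := perm_reflect h1
  have hg : gaps ((0 :: t).map (v + 1 - 1 - ·)) = lengthMultiset a x b y c := by
    rw [gaps_reflect (fun p hp => List.mem_range.1 (h1.mem_iff.1 hp)), h2]
  have hg' : gaps ((0 :: t').map (v + ·)) = lengthMultiset a' x b' y c' := by
    rw [gaps_map _ _ (fun p _ q _ => by unfold Nat.dist; omega), h2']
  simp only [List.map_cons, add_zero, Nat.add_sub_cancel, Nat.sub_zero] at hp hg hg'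
  have hpt : (t.map (v - ·)).Perm (List.range v) := by
    rw [List.range_succ] at hp
    have := hp.trans (List.perm_append_singleton v _)
    exact (List.perm_cons v).1 this
  have hl : ((t.map (v - ·)).reverse ++ (0 :: t').map (v + ·)).Perm
      (List.range (v + (a' + b' + c' + 1))) :=
    perm_map_add_append ((List.reverse_perm _).trans hpt) h1'
  have := hasLinearRealization_of_perm (by omega) hl
  rw [List.map_cons, add_zero, gaps_append_cons, hg', ← List.reverse_cons, gaps_reverse, hg,
    lengthMultiset_add] at this
  exact this

/-! ### Configurations and elementary extensions -/

/-- There is a path on `0, …, a + b + c` with edge lengths `{1^a, x^b, y^c}`, first vertex `h` and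
last vertex `e`, in which any two vertices related by `P` are neighbours (in the order given, when
`d` is `true`). Such neighbours are the places where the path can be extended. -/
def Config (d : Bool) (x y a b c h e : ℕ) (P : ℕ → ℕ → Prop) : Prop :=
  ∃ l : List ℕ, l.Perm (List.range (a + b + c + 1)) ∧ gaps l = lengthMultiset a x b y c ∧
    l.head? = some h ∧ l.getLast? = some e ∧ ∀ p q, P p q → Nb d l p q

namespace Config

variable {d : Bool} {x y a b c h e a' b' c' h' e' : ℕ} {P P' : ℕ → ℕ → Prop}

theorem standard (H : Config d x y a b c 0 e P) : Standard x y a b c := by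
  obtain ⟨l, h1, h2, h3, -⟩ := H
  exact ⟨l, h1, h2, h3⟩

theorem hasLinearRealization (H : Config d x y a b c h e P) :
    HasLinearRealization (lengthMultiset a x b y c) := by
  obtain ⟨l, h1, h2, -⟩ := H
  exact h2 ▸ hasLinearRealization_of_perm (Nat.succ_pos _) h1

theorem swap (H : Config d x y a b c h e P) : Config d y x a c b h e P := by
  obtain ⟨l, h1, h2, h3⟩ := H
  exact ⟨l, by rwa [add_right_comm a c b], by rw [h2, lengthMultiset_swap], h3⟩

theorem mono (H : Config d x y a b c h e P) (hP : ∀ p q, P' p q → P p q) :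
    Config d x y a b c h e P' := by
  obtain ⟨l, h1, h2, h3, h4, h5⟩ := H
  exact ⟨l, h1, h2, h3, h4, fun p q hpq => h5 p q (hP p q hpq)⟩

theorem undirected (H : Config d x y a b c h e P) : Config false x y a b c h e P := by
  obtain ⟨l, h1, h2, h3, h4, h5⟩ := H
  exact ⟨l, h1, h2, h3, h4, fun p q hpq => (h5 p q hpq).imp id fun h => ⟨rfl, h.2⟩⟩

theorem cast (H : Config d x y a b c h e P) (ha : a = a') (hb : b = b') (hc : c = c')
    (hh : h = h') (he : e = e') (hP : ∀ p q, P' p q → P p q) :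
    Config d x y a' b' c' h' e' P' := by
  subst ha hb hc hh he
  exact H.mono hP

theorem perm_extend {l l' m : List ℕ} {v k v' : ℕ} (hl : l.Perm (List.range v))
    (hm : m.Perm ((List.range k).map (v + ·))) (h : l'.Perm (m ++ l)) (hv : v' = v + k) :
    l'.Perm (List.range v') := by
  rw [hv, List.range_add]
  exact h.trans ((List.perm_append_comm).trans (hl.append hm))

/-- Insertion of the `k` new vertices between two neighbours, in the order `m`. -/
theorem insert (H : Config d x y a b c h e P) {p q : ℕ} (hpq : P p q) (k : ℕ) (m : List ℕ)
    (hm : m.Perm ((List.range k).map (a + b + c + 1 + ·))) (hk : a' + b' + c' = a + b + c + k)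
    (hg : lengthMultiset a x b y c + gaps (p :: (m ++ [q])) =
      lengthMultiset a' x b' y c' + {Nat.dist p q})
    (hP : ∀ r s, P' r s → P r s ∧ ¬(r = p ∧ s = q) ∧ ¬(r = q ∧ s = p) ∨
      Nb d (p :: (m ++ [q])) r s) :
    Config d x y a' b' c' h e P' := by
  obtain ⟨l, h1, h2, h3, h4, h5⟩ := H
  obtain ⟨l', g1, g2, g3, g4, g5, g6⟩ := exists_insert (h5 p q hpq) m
  refine ⟨l', perm_extend h1 hm g1 (by omega), ?_, g3.trans h3, g4.trans h4, fun r s hr => ?_⟩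
  · rw [h2, hg] at g2; exact add_right_cancel g2
  · rcases hP r s hr with ⟨k1, k2, k3⟩ | k1
    · exact g5 r s (h5 r s k1) k2 k3
    · exact g6 r s k1

/-- The `k` new vertices follow at the end of the path, in the order `m`. -/
theorem append (H : Config d x y a b c h e P) (k : ℕ) (m : List ℕ)
    (hm : m.Perm ((List.range k).map (a + b + c + 1 + ·))) (hk : a' + b' + c' = a + b + c + k)
    (hg : lengthMultiset a x b y c + gaps (e :: m) = lengthMultiset a' x b' y c')
    (he : (e :: m).getLast? = some e')
    (hP : ∀ r s, P' r s → P r s ∨ Nb d (e :: m) r s) :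
    Config d x y a' b' c' h e' P' := by
  obtain ⟨l, h1, h2, h3, h4, h5⟩ := H
  obtain ⟨l', g1, g2, g3, g4, g5, g6⟩ := exists_append (d := d) h4 m
  refine ⟨l', perm_extend h1 hm g1 (by omega), ?_, g3.trans h3, g4.trans he, fun r s hr => ?_⟩
  · rw [h2, hg] at g2; exact g2
  · rcases hP r s hr with k1 | k1
    · exact g5 r s (h5 r s k1)
    · exact g6 r s k1

/-- The path is cut between `q` and its successor `q'`, and `q` is connected to the last vertex
through the new vertices. The direction of the part behind the cut changes, so only undirected
neighbours are recorded afterwards. -/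
theorem rotate (H : Config true x y a b c h e P) {q q' : ℕ} (hpq : P q q') (k : ℕ) (m : List ℕ)
    (hm : m.Perm ((List.range k).map (a + b + c + 1 + ·))) (hk : a' + b' + c' = a + b + c + k)
    (hg : lengthMultiset a x b y c + gaps (q :: (m ++ [e])) =
      lengthMultiset a' x b' y c' + {Nat.dist q q'})
    (hP : ∀ r s, P' r s → P r s ∧ ¬(r = q ∧ s = q') ∨ Nb false (q :: (m ++ [e])) r s) :
    Config false x y a' b' c' h q' P' := by
  obtain ⟨l, h1, h2, h3, h4, h5⟩ := H
  have h6 : ∀ r s, P r s → [r, s] <:+: l := fun r s hr => (h5 r s hr).resolve_right (by simp)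
  obtain ⟨l', g1, g2, g3, g4, g5, g6⟩ := exists_rotate (h6 q q' hpq) h4 m
  refine ⟨l', perm_extend h1 hm g1 (by omega), ?_, g3.trans h3, g4, fun r s hr => ?_⟩
  · rw [h2, hg] at g2; exact add_right_cancel g2
  · rcases hP r s hr with ⟨k1, k2⟩ | k1
    · exact g5 r s (h6 r s k1) k2
    · exact g6 r s k1

theorem toUndirected (H : Config d x y a b c h e P) (hP : ∀ p q, P' p q → P p q ∨ P q p) :
    Config false x y a b c h e P' := by
  obtain ⟨l, h1, h2, h3, h4, h5⟩ := H.undirected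
  refine ⟨l, h1, h2, h3, h4, fun p q hpq => ?_⟩
  rcases hP p q hpq with h | h
  · exact h5 p q h
  · exact (h5 q p h).symm.imp (fun h => h.2) fun h => ⟨rfl, h⟩

/-- One step of `pairs`: the vertices `v`, `v + 1` enter between `v - x` and `v - x + 1`. -/
theorem pair (H : Config d x y a b c h e P) {i j p : ℕ} (hij : i = 0 ∧ j = 1 ∨ i = 1 ∧ j = 0)
    (hp : p + x = a + b + c + 1) (hpq : P (p + i) (p + j))
    (hP : ∀ r s, P' r s → P r s ∧ ¬(r = p + i ∧ s = p + j) ∧ ¬(r = p + j ∧ s = p + i) ∨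
      r = a + b + c + 1 + i ∧ s = a + b + c + 1 + j) :
    Config d x y a (b + 2) c h e P' := by
  refine H.insert hpq 2 [a + b + c + 1 + i, a + b + c + 1 + j] ?_ (by omega) ?_ ?_
  · rcases hij with ⟨rfl, rfl⟩ | ⟨rfl, rfl⟩
    · exact List.Perm.refl _
    · exact List.Perm.swap _ _ _
  · have e1 : Nat.dist (p + i) (a + b + c + 1 + i) = x := dist_of_add_eq (by omega)
    have e2 : Nat.dist (a + b + c + 1 + i) (a + b + c + 1 + j) = 1 := by unfold Nat.dist; omega
    have e3 : Nat.dist (a + b + c + 1 + j) (p + j) = x := dist_of_add_eq' (by omega)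
    have e4 : Nat.dist (p + i) (p + j) = 1 := by unfold Nat.dist; omega
    simp only [List.cons_append, List.nil_append, gaps_cons_cons, gaps_singleton, add_zero, e1, e2,
      e3, e4, singleton_one_eq x y, singleton_left_eq x y, lengthMultiset_add]
  · intro r s hr
    refine (hP r s hr).imp id ?_
    rintro ⟨rfl, rfl⟩
    exact Or.inl ⟨[p + i], [p + j], by simp⟩

/-- The vertices `v, v + 1, …, v + 2k - 1` enter pairwise, each pair `{t, t + 1}` between the
neighbours `t - x`, `t - x + 1`. When `x` is even the new pairs can themselves be used, so `k` is
arbitrary. The numbers `i`, `j` say in which order the pairs are traversed. -/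
theorem pairs (H : Config d x y a b c h e P) (i j k : ℕ)
    (hij : i = 0 ∧ j = 1 ∨ i = 1 ∧ j = 0) (hx : 0 < x) (hxv : x ≤ a + b + c + 1)
    (hk : x % 2 = 0 ∨ 2 * k ≤ x)
    (hA : ∀ p, a + b + c + 1 ≤ p + x → p + x < a + b + c + 1 + 2 * k →
      (p + x) % 2 = (a + b + c + 1) % 2 → p < a + b + c + 1 → P (p + i) (p + j))
    (hP : ∀ r s, P' r s → (P r s ∧ (r + x < a + b + c + 1 ∨ a + b + c + 1 + 2 * k ≤ r + x ∨
        s + x < a + b + c + 1 ∨ a + b + c + 1 + 2 * k ≤ s + x)) ∨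
      (r + j = s + i ∧ a + b + c + 1 + i ≤ r ∧ r < a + b + c + 1 + 2 * k + i ∧
        (r + i) % 2 = (a + b + c + 1) % 2 ∧ a + b + c + 1 + 2 * k + i ≤ r + x)) :
    Config d x y a (b + 2 * k) c h e P' := by
  induction k generalizing P' with
  | zero =>
    refine H.mono fun r s hr => ?_
    rcases hP r s hr with h | h
    · exact h.1
    · omega
  | succ k ih =>
    have H' := ih (by omega) (fun p h1 h2 h3 h4 => hA p h1 (by omega) h3 h4)
      (P' := fun r s => (P r s ∧ (r + x < a + b + c + 1 ∨ a + b + c + 1 + 2 * k ≤ r + x ∨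
        s + x < a + b + c + 1 ∨ a + b + c + 1 + 2 * k ≤ s + x)) ∨
      (r + j = s + i ∧ a + b + c + 1 + i ≤ r ∧ r < a + b + c + 1 + 2 * k + i ∧
        (r + i) % 2 = (a + b + c + 1) % 2 ∧ a + b + c + 1 + 2 * k + i ≤ r + x))
      (fun r s hr => hr)
    obtain ⟨p, hp⟩ : ∃ p, p + x = a + b + c + 1 + 2 * k := ⟨a + b + c + 1 + 2 * k - x, by omega⟩
    refine H'.pair (p := p) hij (by omega) ?_ ?_
    · by_cases hpv : p < a + b + c + 1
      · exact Or.inl ⟨hA p (by omega) (by omega) (by omega) hpv, by omega⟩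
      · right; omega
    · intro r s hr
      rcases hP r s hr with ⟨h1, h2⟩ | h1
      · left
        exact ⟨Or.inl ⟨h1, by omega⟩, by omega, by omega⟩
      · by_cases h2 : r < a + b + c + 1 + 2 * k + i
        · left
          exact ⟨Or.inr (by omega), by omega, by omega⟩
        · right; omega

/-- `pairs` for the larger length `y`. -/
theorem pairsY (H : Config d x y a b c h e P) (i j k : ℕ)
    (hij : i = 0 ∧ j = 1 ∨ i = 1 ∧ j = 0) (hy : 0 < y) (hyv : y ≤ a + b + c + 1)
    (hk : y % 2 = 0 ∨ 2 * k ≤ y)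
    (hA : ∀ p, a + b + c + 1 ≤ p + y → p + y < a + b + c + 1 + 2 * k →
      (p + y) % 2 = (a + b + c + 1) % 2 → p < a + b + c + 1 → P (p + i) (p + j))
    (hP : ∀ r s, P' r s → (P r s ∧ (r + y < a + b + c + 1 ∨ a + b + c + 1 + 2 * k ≤ r + y ∨
        s + y < a + b + c + 1 ∨ a + b + c + 1 + 2 * k ≤ s + y)) ∨
      (r + j = s + i ∧ a + b + c + 1 + i ≤ r ∧ r < a + b + c + 1 + 2 * k + i ∧
        (r + i) % 2 = (a + b + c + 1) % 2 ∧ a + b + c + 1 + 2 * k + i ≤ r + y)) :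
    Config d x y a b (c + 2 * k) h e P' := by
  refine (H.swap.pairs (P' := P') i j k hij hy (by omega) hk ?_ ?_).swap
  · intro p; rw [add_right_comm a c b]; exact hA p
  · intro r s; rw [add_right_comm a c b]; exact hP r s

/-- `pairs` as the last step of a construction. -/
theorem pairsX_end (H : Config d x y a b c h e P) (i j k : ℕ)
    (hij : i = 0 ∧ j = 1 ∨ i = 1 ∧ j = 0) (hx : 0 < x) (hxv : x ≤ a + b + c + 1)
    (hk : x % 2 = 0 ∨ 2 * k ≤ x)
    (hA : ∀ p, a + b + c + 1 ≤ p + x → p + x < a + b + c + 1 + 2 * k →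
      (p + x) % 2 = (a + b + c + 1) % 2 → p < a + b + c + 1 → P (p + i) (p + j)) :
    Config d x y a (b + 2 * k) c h e (fun _ _ => False) :=
  H.pairs i j k hij hx hxv hk hA fun _ _ h => h.elim

theorem pairsY_end (H : Config d x y a b c h e P) (i j k : ℕ)
    (hij : i = 0 ∧ j = 1 ∨ i = 1 ∧ j = 0) (hy : 0 < y) (hyv : y ≤ a + b + c + 1)
    (hk : y % 2 = 0 ∨ 2 * k ≤ y)
    (hA : ∀ p, a + b + c + 1 ≤ p + y → p + y < a + b + c + 1 + 2 * k →
      (p + y) % 2 = (a + b + c + 1) % 2 → p < a + b + c + 1 → P (p + i) (p + j)) :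
    Config d x y a b (c + 2 * k) h e (fun _ _ => False) :=
  H.pairsY i j k hij hy hyv hk hA fun _ _ h => h.elim

theorem appendX (H : Config d x y a b c h e P) (he : e + x = a + b + c + 1) (he' : e' = e + x)
    (hP : ∀ r s, P' r s → P r s ∨ r = e ∧ s = e + x) :
    Config d x y a (b + 1) c h e' P' := by
  refine H.append 1 [e + x] ?_ (by omega) ?_ (by simp [he']) ?_
  · rw [he]; exact List.Perm.refl _
  · have e1 : Nat.dist e (e + x) = x := dist_of_add_eq (by omega)
    simp only [gaps_cons_cons, gaps_singleton, add_zero, e1, singleton_left_eq x y,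
      lengthMultiset_add]
  · intro r s hr
    refine (hP r s hr).imp id ?_
    rintro ⟨rfl, rfl⟩
    exact Or.inl (List.infix_refl _)

theorem appendY (H : Config d x y a b c h e P) (he : e + y = a + b + c + 1) (he' : e' = e + y)
    (hP : ∀ r s, P' r s → P r s ∨ r = e ∧ s = e + y) :
    Config d x y a b (c + 1) h e' P' :=
  (H.swap.appendX (by omega) he' hP).swap

theorem appendOne (H : Config d x y a b c h e P) (he : e + 1 = a + b + c + 1) (he' : e' = e + 1)
    (hP : ∀ r s, P' r s → P r s ∨ r = e ∧ s = e + 1) :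
    Config d x y (a + 1) b c h e' P' := by
  refine H.append 1 [e + 1] ?_ (by omega) ?_ (by simp [he']) ?_
  · rw [he]; exact List.Perm.refl _
  · have e1 : Nat.dist e (e + 1) = 1 := dist_of_add_eq (by omega)
    simp only [gaps_cons_cons, gaps_singleton, add_zero, e1, singleton_one_eq x y,
      lengthMultiset_add]
  · intro r s hr
    refine (hP r s hr).imp id ?_
    rintro ⟨rfl, rfl⟩
    exact Or.inl (List.infix_refl _)

/-- The vertices `v + 1`, `v` at the end of the path, in this order. -/
theorem appendPairX (H : Config false x y a b c h e P) (he : e + x = a + b + c + 2)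
    (he' : e' = a + b + c + 1)
    (hP : ∀ r s, P' r s → P r s ∨ r = a + b + c + 1 ∧ s = a + b + c + 2) :
    Config false x y (a + 1) (b + 1) c h e' P' := by
  refine H.append 2 [a + b + c + 2, a + b + c + 1] ?_ (by omega) ?_ (by simp [he']) ?_
  · exact List.Perm.swap _ _ _
  · have e1 : Nat.dist e (a + b + c + 2) = x := dist_of_add_eq (by omega)
    have e2 : Nat.dist (a + b + c + 2) (a + b + c + 1) = 1 := dist_of_add_eq' (by omega)
    simp only [gaps_cons_cons, gaps_singleton, add_zero, e1, e2, singleton_one_eq x y,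
      singleton_left_eq x y, lengthMultiset_add]
  · intro r s hr
    refine (hP r s hr).imp id ?_
    rintro ⟨rfl, rfl⟩
    exact Or.inr ⟨rfl, [e], [], by simp⟩

theorem appendPairY (H : Config false x y a b c h e P) (he : e + y = a + b + c + 2)
    (he' : e' = a + b + c + 1)
    (hP : ∀ r s, P' r s → P r s ∨ r = a + b + c + 1 ∧ s = a + b + c + 2) :
    Config false x y (a + 1) b (c + 1) h e' P' := by
  refine (H.swap.appendPairX (P' := P') (by omega) (by omega) ?_).swap
  rw [add_right_comm a c b]; exact hP

/-- Turning the end of the path around: `…, p, p + 1, …, p + 2` becomes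
`…, p, v, v + 1, v + 2, p + 2, …, p + 1` with `v = p + x`. -/
theorem turnX {p : ℕ} (H : Config true x y a b c h (p + 2) P)
    (hp : p + x = a + b + c + 1) (hpq : P p (p + 1)) (he' : e' = p + 1)
    (hP : ∀ r s, P' r s → P r s ∧ ¬(r = p ∧ s = p + 1) ∨
      s = r + 1 ∧ (r = a + b + c + 1 ∨ r = a + b + c + 2)) :
    Config false x y (a + 1) (b + 2) c h e' P' := by
  subst he'
  refine H.rotate hpq 3 [a + b + c + 1, a + b + c + 2, a + b + c + 3] (List.Perm.refl _) (by omega)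
    ?_ ?_
  · have e1 : Nat.dist p (a + b + c + 1) = x := dist_of_add_eq (by omega)
    have e2 : Nat.dist (a + b + c + 1) (a + b + c + 2) = 1 := dist_of_add_eq (by omega)
    have e3 : Nat.dist (a + b + c + 2) (a + b + c + 3) = 1 := dist_of_add_eq (by omega)
    have e4 : Nat.dist (a + b + c + 3) (p + 2) = x := dist_of_add_eq' (by omega)
    have e5 : Nat.dist p (p + 1) = 1 := dist_of_add_eq (by omega)
    simp only [List.cons_append, List.nil_append, gaps_cons_cons, gaps_singleton, add_zero, e1, e2,
      e3, e4, e5, singleton_one_eq x y, singleton_left_eq x y, lengthMultiset_add]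
  · intro r s hr
    refine (hP r s hr).imp id ?_
    rintro ⟨rfl, rfl | rfl⟩
    · exact Or.inl ⟨[p], [a + b + c + 3, p + 2], by simp⟩
    · exact Or.inl ⟨[p, a + b + c + 1], [p + 2], by simp⟩

theorem turnY {p : ℕ} (H : Config true x y a b c h (p + 2) P)
    (hp : p + y = a + b + c + 1) (hpq : P p (p + 1)) (he' : e' = p + 1)
    (hP : ∀ r s, P' r s → P r s ∧ ¬(r = p ∧ s = p + 1) ∨
      s = r + 1 ∧ (r = a + b + c + 1 ∨ r = a + b + c + 2)) :
    Config false x y (a + 1) b (c + 2) h e' P' := by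
  refine (H.swap.turnX (P' := P') (by omega) hpq he' ?_).swap
  rw [add_right_comm a c b]; exact hP

/-- The mirror image of `turnY`: `…, e + 2, e + 1, …, e` becomes
`…, e + 2, v + 2, v + 1, v, e, …, e + 1` with `v = e + y`. -/
theorem turnDownY (H : Config true x y a b c h e P)
    (hp : e + y = a + b + c + 1) (hpq : P (e + 2) (e + 1)) (he' : e' = e + 1)
    (hP : ∀ r s, P' r s → P r s ∧ ¬(r = e + 2 ∧ s = e + 1) ∨ P s r ∧ ¬(r = e + 1 ∧ s = e + 2) ∨
      s = r + 1 ∧ (r = a + b + c + 1 ∨ r = a + b + c + 2)) :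
    Config false x y (a + 1) b (c + 2) h e' P' := by
  subst he'
  refine (H.rotate (a' := a + 1) (b' := b) (c' := c + 2) hpq 3
    [a + b + c + 3, a + b + c + 2, a + b + c + 1] ?_ (by omega)
    (P' := fun r s => P r s ∧ ¬(r = e + 2 ∧ s = e + 1) ∨
      r = s + 1 ∧ (s = a + b + c + 1 ∨ s = a + b + c + 2)) ?_ ?_).toUndirected ?_
  · exact List.reverse_perm [a + b + c + 1, a + b + c + 2, a + b + c + 3]
  · have e1 : Nat.dist (e + 2) (a + b + c + 3) = y := dist_of_add_eq (by omega)
    have e2 : Nat.dist (a + b + c + 2) (a + b + c + 1) = 1 := dist_of_add_eq' (by omega)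
    have e3 : Nat.dist (a + b + c + 3) (a + b + c + 2) = 1 := dist_of_add_eq' (by omega)
    have e4 : Nat.dist (a + b + c + 1) e = y := dist_of_add_eq' (by omega)
    have e5 : Nat.dist (e + 2) (e + 1) = 1 := dist_of_add_eq' (by omega)
    simp only [List.cons_append, List.nil_append, gaps_cons_cons, gaps_singleton, add_zero, e1, e2,
      e3, e4, e5, singleton_one_eq x y, singleton_right_eq x y, lengthMultiset_add]
  · intro r s hr
    refine hr.imp id ?_
    rintro ⟨rfl, rfl | rfl⟩
    · exact Or.inl ⟨[e + 2, a + b + c + 3], [e], by simp⟩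
    · exact Or.inl ⟨[e + 2], [a + b + c + 1, e], by simp⟩
  · intro r s hr
    rcases hP r s hr with h | h | h
    · exact Or.inl (Or.inl h)
    · exact Or.inr (Or.inl ⟨h.1, by omega⟩)
    · exact Or.inr (Or.inr h)

/-- The edge `q, q + 1` is replaced by `q, v, v + 1, e` with `v = q + y` and `v + 1 = e + x`. -/
theorem turnXY {q : ℕ} (H : Config true x y a b c h e P)
    (hq : q + y = a + b + c + 1) (he : e + x = a + b + c + 2) (hpq : P q (q + 1)) (he' : e' = q + 1)
    (hP : ∀ r s, P' r s → P r s ∧ ¬(r = q ∧ s = q + 1) ∨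
      s = r + 1 ∧ r = a + b + c + 1) :
    Config false x y a (b + 1) (c + 1) h e' P' := by
  subst he'
  refine H.rotate hpq 2 [a + b + c + 1, a + b + c + 2] (List.Perm.refl _) (by omega)
    ?_ ?_
  · have e1 : Nat.dist q (a + b + c + 1) = y := dist_of_add_eq (by omega)
    have e2 : Nat.dist (a + b + c + 1) (a + b + c + 2) = 1 := dist_of_add_eq (by omega)
    have e4 : Nat.dist (a + b + c + 2) e = x := dist_of_add_eq' (by omega)
    have e5 : Nat.dist q (q + 1) = 1 := dist_of_add_eq (by omega)
    simp only [List.cons_append, List.nil_append, gaps_cons_cons, gaps_singleton, add_zero, e1, e2,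
      e4, e5, singleton_one_eq x y, singleton_left_eq x y, singleton_right_eq x y,
      lengthMultiset_add]
  · intro r s hr
    refine (hP r s hr).imp id ?_
    rintro ⟨rfl, rfl⟩
    exact Or.inl ⟨[q], [e], by simp⟩

/-- The edge `q, q + 1` is replaced by an edge of length `x` from `q` to the last vertex. -/
theorem rotateX {q : ℕ} (H : Config true x y (a + 1) b c h e P) (hq : q + x = e)
    (hpq : P q (q + 1)) (he' : e' = q + 1)
    (hP : ∀ r s, P' r s → P r s ∧ ¬(r = q ∧ s = q + 1)) :
    Config false x y a (b + 1) c h e' P' := by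
  subst he'
  refine H.rotate hpq 0 [] (List.Perm.refl _) (by omega)
    ?_ ?_
  · have e1 : Nat.dist q e = x := dist_of_add_eq (by omega)
    have e5 : Nat.dist q (q + 1) = 1 := dist_of_add_eq (by omega)
    simp only [List.nil_append, gaps_cons_cons, gaps_singleton, add_zero, e1,
      e5, singleton_one_eq x y, singleton_left_eq x y, lengthMultiset_add]
  · exact fun r s hr => Or.inl (hP r s hr)

/-- For `y = x + 1`: the vertex `v` enters between `v - y` and `v - x`. -/
theorem single {p : ℕ} (H : Config false x (x + 1) (a + 1) b c h e P)
    (hp : p + x = a + b + c + 1) (hpq : P p (p + 1))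
    (hP : ∀ r s, P' r s → P r s ∧ ¬(r = p ∧ s = p + 1) ∧ ¬(r = p + 1 ∧ s = p)) :
    Config false x (x + 1) a (b + 1) (c + 1) h e P' := by
  refine H.insert hpq 1 [a + 1 + b + c + 1] (List.Perm.refl _) (by omega) ?_ ?_
  · have e1 : Nat.dist p (a + 1 + b + c + 1) = x + 1 := dist_of_add_eq (by omega)
    have e2 : Nat.dist (a + 1 + b + c + 1) (p + 1) = x := dist_of_add_eq' (by omega)
    have e5 : Nat.dist p (p + 1) = 1 := dist_of_add_eq (by omega)
    simp only [List.cons_append, List.nil_append, gaps_cons_cons, gaps_singleton, add_zero, e1,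
      e2, e5, singleton_one_eq x (x + 1), singleton_left_eq x (x + 1),
      singleton_right_eq x (x + 1), lengthMultiset_add]
  · exact fun r s hr => Or.inl (hP r s hr)

/-- For `y = x + 1`: the vertices `v`, `v + 1`, `v + 2` enter between `v - x` and `v + 2 - y`. -/
theorem triple {p : ℕ} (H : Config false x (x + 1) a b c h e P)
    (hp : p + x = a + b + c + 1) (hpq : P p (p + 1))
    (hP : ∀ r s, P' r s → P r s ∧ ¬(r = p ∧ s = p + 1) ∧ ¬(r = p + 1 ∧ s = p) ∨
      s = r + 1 ∧ (r = a + b + c + 1 ∨ r = a + b + c + 2)) :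
    Config false x (x + 1) (a + 1) (b + 1) (c + 1) h e P' := by
  refine H.insert hpq 3 [a + b + c + 1, a + b + c + 2, a + b + c + 3] (List.Perm.refl _) (by omega)
    ?_ ?_
  · have e1 : Nat.dist p (a + b + c + 1) = x := dist_of_add_eq (by omega)
    have e2 : Nat.dist (a + b + c + 1) (a + b + c + 2) = 1 := dist_of_add_eq (by omega)
    have e3 : Nat.dist (a + b + c + 2) (a + b + c + 3) = 1 := dist_of_add_eq (by omega)
    have e4 : Nat.dist (a + b + c + 3) (p + 1) = x + 1 := dist_of_add_eq' (by omega)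
    have e5 : Nat.dist p (p + 1) = 1 := dist_of_add_eq (by omega)
    simp only [List.cons_append, List.nil_append, gaps_cons_cons, gaps_singleton, add_zero, e1,
      e2, e3, e4, e5, singleton_one_eq x (x + 1), singleton_left_eq x (x + 1),
      singleton_right_eq x (x + 1), lengthMultiset_add]
  · intro r s hr
    refine (hP r s hr).imp id ?_
    rintro ⟨rfl, rfl | rfl⟩
    · exact Or.inl ⟨[p], [a + b + c + 3, p + 1], by simp⟩
    · exact Or.inl ⟨[p, a + b + c + 1], [p + 1], by simp⟩

/-- For `y = x + 1`: the last vertex `e`, preceded by `e - y`, moves between `e + 2` and `e + 1`,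
together with the new vertices `v = e + y` and `v + 1`:
`…, e + 2, e + 1, …, e - y, e` becomes `…, e + 2, v + 1, v, e, e + 1, …, e - y`. -/
theorem moveLast {p : ℕ} (H : Config true x (x + 1) a b c h e P)
    (hv : e + x = a + b + c) (hp : p + (x + 1) = e) (h1 : P p e) (h2 : P (e + 2) (e + 1))
    (hP : ∀ r s, P' r s → (P r s ∨ P s r) ∧ r ≠ e ∧ s ≠ e ∧ ¬(r = e + 2 ∧ s = e + 1) ∧
      ¬(r = e + 1 ∧ s = e + 2) ∨ s = r + 1 ∧ (r = a + b + c + 1 ∨ r = e)) :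
    Config false x (x + 1) (a + 1) (b + 1) c h p P' := by
  obtain ⟨l, g1, g2, g3, g4, g5⟩ := H
  have g6 : ∀ r s, P r s → [r, s] <:+: l := fun r s hr => (g5 r s hr).resolve_right (by simp)
  obtain ⟨l₀, rfl⟩ := List.getLast?_eq_some_iff.1 g4
  have hnd : (l₀ ++ [e]).Nodup := g1.nodup_iff.2 List.nodup_range
  have hne : e ∉ l₀ := fun hm => (List.nodup_append.1 hnd).2.2 e hm e (by simp) rfl
  -- every adjacency not involving `e` is already one of `l₀`
  have g7 : ∀ r s, P r s → s ≠ e → [r, s] <:+: l₀ := by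
    intro r s hr hs
    have := g6 r s hr
    rw [pair_infix_append] at this
    rcases this with h | h | h
    · exact h
    · have := h.length_le; simp at this
    · simp only [List.head?_cons, Option.some.injEq] at h; exact absurd h.2.symm hs
  have hlast : l₀.getLast? = some p := by
    have := g6 p e h1
    rw [pair_infix_append] at this
    rcases this with h | h | h
    · exact absurd (h.subset (by simp)) hne
    · have := h.length_le; simp at this
    · exact h.1
  have h3 : Nb false l₀ (e + 2) (e + 1) := Or.inl (g7 _ _ h2 (by omega))
  obtain ⟨l', k1, k2, k3, k4, k5, k6⟩ :=
    exists_insert h3 [a + b + c + 2, a + b + c + 1, e]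
  refine ⟨l', ?_, ?_, ?_, k4.trans hlast, ?_⟩
  · refine perm_extend g1 (m := [a + b + c + 2, a + b + c + 1]) (k := 2)
      (List.Perm.swap _ _ _) (k1.trans ?_) (by omega)
    rw [List.perm_iff_count]; intro z; simp [List.count_cons]
  · obtain ⟨l₁, rfl⟩ := List.getLast?_eq_some_iff.1 hlast
    have e0 : Nat.dist p e = x + 1 := dist_of_add_eq (by omega)
    have e1 : Nat.dist (e + 2) (a + b + c + 2) = x := dist_of_add_eq (by omega)
    have e2 : Nat.dist (a + b + c + 2) (a + b + c + 1) = 1 := dist_of_add_eq' (by omega)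
    have e3 : Nat.dist (a + b + c + 1) e = x + 1 := dist_of_add_eq' (by omega)
    have e4 : Nat.dist e (e + 1) = 1 := dist_of_add_eq (by omega)
    have e5 : Nat.dist (e + 2) (e + 1) = 1 := dist_of_add_eq' (by omega)
    rw [List.append_assoc, List.singleton_append, gaps_append_cons] at g2
    simp only [List.cons_append, List.nil_append, gaps_cons_cons, gaps_singleton, add_zero, e0, e1,
      e2, e3, e4, e5] at g2 k2
    apply add_right_cancel (b := ({1} : Multiset ℕ) + {x + 1})
    rw [← add_assoc, k2]
    calc _ = (gaps (l₁ ++ [p]) + {x + 1}) + ({x} + {1} + {x + 1} + {1}) := by abel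
      _ = _ := by
        rw [g2]
        simp only [singleton_one_eq x (x + 1), singleton_left_eq x (x + 1),
          singleton_right_eq x (x + 1), lengthMultiset_add]
  · rw [k3, ← g3]
    cases l₀ with
    | nil => simp at hlast
    | cons z t => simp
  · intro r s hr
    rcases hP r s hr with ⟨hrs, n1, n2, n3, n4⟩ | ⟨hs, hr' | hr'⟩
    · refine k5 r s ?_ n3 n4
      rcases hrs with hrs | hrs
      · exact Or.inl (g7 r s hrs n2)
      · exact Or.inr ⟨rfl, g7 s r hrs n1⟩
    · subst hs hr'; exact k6 _ _ (Or.inr ⟨rfl, [e + 2], [e, e + 1], by simp⟩)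
    · rw [hs, hr']; exact k6 _ _ (Or.inl ⟨[e + 2, a + b + c + 2, a + b + c + 1], [], by simp⟩)

end Config

/-! ### Base paths and rows -/

theorem gaps_range' (s n : ℕ) : gaps (List.range' s (n + 1)) = Multiset.replicate n 1 := by
  induction n generalizing s with
  | zero => rfl
  | succ n ih =>
    have := ih (s + 1)
    rw [List.range'_succ] at this
    rw [List.range'_succ, List.range'_succ, gaps_cons_cons, this, dist_of_add_eq (d := 1) rfl,
      Multiset.replicate_succ, Multiset.singleton_add]

theorem pair_infix_range' {s n p : ℕ} (h1 : s ≤ p) (h2 : p + 1 < s + n) :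
    [p, p + 1] <:+: List.range' s n := by
  refine ⟨List.range' s (p - s), List.range' (p + 2) (s + n - (p + 2)), ?_⟩
  have e1 : List.range' s (p - s) ++ [p, p + 1] = List.range' s (p - s + 2) := by
    rw [← List.range'_append_1, show s + (p - s) = p by omega]; rfl
  rw [e1]
  conv_rhs => rw [show n = (p - s + 2) + (s + n - (p + 2)) by omega, ← List.range'_append_1]
  rw [show s + (p - s + 2) = p + 2 by omega]

namespace Config

variable {x y : ℕ}

/-- The path `0, 1, …, m`. -/
theorem ascending (x y m : ℕ) :
    Config true x y m 0 0 0 m (fun r s => s = r + 1 ∧ s ≤ m) := by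
  refine ⟨List.range' 0 (m + 1), ?_, ?_, ?_, ?_, ?_⟩
  · rw [← List.range_eq_range']
  · rw [gaps_range']; simp [lengthMultiset]
  · simp [List.range'_succ]
  · simp [List.range'_concat]
  · rintro r s ⟨rfl, h⟩
    exact Or.inl (pair_infix_range' (by omega) (by omega))

/-- The path `0, x, x - 1, …, 1`. -/
theorem descending (x y : ℕ) (hx : 0 < x) :
    Config true x y (x - 1) 1 0 0 1 (fun r s => r = s + 1 ∧ 0 < s ∧ r ≤ x) := by
  obtain ⟨n, rfl⟩ : ∃ n, x = n + 1 := ⟨x - 1, by omega⟩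
  have e : (List.range' 1 (n + 1)).reverse = (n + 1) :: (List.range' 1 n).reverse := by
    rw [List.range'_concat]; simp [add_comm]
  refine ⟨0 :: (List.range' 1 (n + 1)).reverse, ?_, ?_, ?_, ?_, ?_⟩
  · have : List.range (n + 1 - 1 + 1 + 0 + 1) = 0 :: List.range' 1 (n + 1) := by
      rw [List.range_eq_range']; rfl
    rw [this]; exact (List.reverse_perm _).cons _
  · rw [e, gaps_cons_cons, ← e, gaps_reverse, gaps_range', dist_of_add_eq (d := n + 1) (by omega)]
    simp [lengthMultiset, add_comm]
  · rfl
  · rw [e, List.getLast?_cons_cons, ← e]; simp [List.range'_succ]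
  · rintro r s ⟨rfl, h1, h2⟩
    refine Or.inl (List.IsInfix.trans ((pair_infix_reverse _ _ _).2 ?_) (List.infix_cons
      (List.infix_refl _)))
    exact pair_infix_range' (by omega) (by omega)

/-- For odd `x`: the rows `{0, …, x - 1}`, `{x, …, 2x - 1}`, …, each connected to the previous one
by `x` edges of length `x`. -/
theorem rowsX (y : ℕ) (hx : x % 2 = 1) (n : ℕ) :
    Config true x y (x - 1) (n * x) 0 0 (n * x + (x - 1))
      (fun r s => s = r + 1 ∧ n * x ≤ r ∧ s < n * x + x ∧ (r + n * x) % 2 = 0) := by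
  induction n with
  | zero => exact (ascending x y (x - 1)).cast rfl (by omega) rfl rfl (by omega) (by omega)
  | succ n ih =>
    have e : (n + 1) * x = n * x + x := by ring
    generalize n * x = N at *
    rw [e]
    have H := ih.pairs 0 1 ((x - 1) / 2) (by omega) (by omega) (by omega) (by omega) (by omega)
      (P' := fun r s => s = r + 1 ∧ N + x ≤ r ∧ s < N + x + x - 1 ∧ (r + (N + x)) % 2 = 0)
      (by omega)
    exact (H.appendX (by omega) rfl (fun r s h => Or.inl h)).cast rfl (by omega) rfl rfl
      (by omega) (by omega)

theorem rowsY (x : ℕ) (hy : y % 2 = 1) (n : ℕ) :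
    Config true x y (y - 1) 0 (n * y) 0 (n * y + (y - 1))
      (fun r s => s = r + 1 ∧ n * y ≤ r ∧ s < n * y + y ∧ (r + n * y) % 2 = 0) :=
  (rowsX x hy n).swap

/-- For odd `x`: the last row of `rowsX`, its final vertices turned around so that every vertex of
the row belongs to a pair of neighbours. -/
theorem turnedRowX (y : ℕ) (hx : x % 2 = 1) (hx1 : 1 < x) (n : ℕ) :
    Config false x y x (n * x + (x - 1)) 0 0 (n * x + (x - 2))
      (fun r s => s = r + 1 ∧ n * x + x ≤ r ∧ s < n * x + x + x ∧ (r + n * x) % 2 = 1) := by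
  have H := rowsX y hx n
  generalize n * x = N at *
  have H1 := H.pairs 0 1 ((x - 3) / 2) (by omega) (by omega) (by omega) (by omega)
    (by omega) (P' := fun r s => s = r + 1 ∧ (r = N + (x - 3) ∨
      N + x ≤ r ∧ s < N + x + (x - 3) ∧ (r + N) % 2 = 1)) (by omega)
  exact ((H1.cast (e' := N + (x - 3) + 2) rfl rfl rfl rfl (by omega)
    (fun _ _ h => h)).turnX (by omega) (by omega) rfl (P' := fun r s => s = r + 1 ∧ N + x ≤ r ∧
      s < N + x + x ∧ (r + N) % 2 = 1) (by omega)).cast (by omega) (by omega) rfl rfl (by omega)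
      (fun _ _ h => h)

theorem turnedRowY (x : ℕ) (hy : y % 2 = 1) (hy1 : 1 < y) (n : ℕ) :
    Config false x y y 0 (n * y + (y - 1)) 0 (n * y + (y - 2))
      (fun r s => s = r + 1 ∧ n * y + y ≤ r ∧ s < n * y + y + y ∧ (r + n * y) % 2 = 1) :=
  (turnedRowX x hy hy1 n).swap

end Config

/-! ### Realizations with two lengths -/

/-- The last `x` vertices of `0, …, x - 1` and of `0, x, x - 1, …, 1` come in pairs, so any number
of pairs of edges of length `x` can be added; the two paths account for the two parities of `b`. -/
theorem standard_of_even {x : ℕ} (y b : ℕ) (hx : x % 2 = 0) (hx0 : 0 < x) :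
    Standard x y (x - 1) b 0 := by
  obtain ⟨k, rfl | rfl⟩ : ∃ k, b = 2 * k ∨ b = 1 + 2 * k := ⟨b / 2, by omega⟩
  · have H := ((Config.ascending x y (x - 1)).pairsX_end 0 1 k (by omega) hx0 (by omega) (by omega)
      (by omega)).standard
    rwa [zero_add] at H
  · exact ((Config.descending x y hx0).pairsX_end 1 0 k (by omega) hx0 (by omega) (by omega)
      (by omega)).standard

/-- With `b = n * x + r`: for even `r` the pairs of a row suffice, for odd `r` those of a turned
row; small `b` are treated separately. -/
theorem standard_of_odd {x : ℕ} (y b : ℕ) (hx : x % 2 = 1) (hx1 : 1 < x) :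
    Standard x y x b 0 := by
  obtain ⟨n, r, hr, rfl⟩ : ∃ n r, r < x ∧ b = n * x + r :=
    ⟨b / x, b % x, Nat.mod_lt _ (by omega), (Nat.div_add_mod' b x).symm⟩
  have H := Config.rowsX y hx n
  rcases Nat.even_or_odd' r with ⟨k, rfl | rfl⟩
  · generalize n * x = N at *
    exact (H.pairsX_end 0 1 k (by omega) (by omega) (by omega) (by omega)
      (by omega)).standard.mono (by omega)
  rcases n with _ | n
  · rcases k with _ | k
    · exact ((Config.descending x y (by omega)).cast rfl (by omega) rfl rfl rfl
        (fun _ _ h => h)).standard.mono (by omega)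
    · -- there is no row to turn, but `0, x, …, 3, 2, 1` can be turned at its end
      have H1 := (Config.descending x y (by omega)).swap.turnDownY (by omega)
        (by omega) rfl (P' := fun r s => s = r + 1 ∧ (3 ≤ r ∧ s ≤ x ∨ x + 1 ≤ r ∧ s ≤ x + 3))
        (by omega)
      have H2 := (H1.swap.pairsX_end 0 1 k (by omega) (by omega) (by omega) (by omega)
      (by omega)).standard
      convert H2 using 1 <;> omega
  · have H := Config.turnedRowX y hx hx1 n
    have e : (n + 1) * x = n * x + x := by ring
    generalize n * x = N at *
    rw [e]
    have H1 := (H.pairsX_end 0 1 (k + 1) (by omega) (by omega) (by omega) (by omega)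
      (by omega)).standard
    convert H1 using 1; omega

theorem hasLinearRealization_of_odd {x y : ℕ} (hx : x % 2 = 1) (hx1 : 1 < x) (hxy : x < y)
    {a : ℕ} (b c : ℕ) (ha : y % 2 = 0 ∧ x + y - 1 ≤ a ∨ y % 2 = 1 ∧ x + y ≤ a) :
    HasLinearRealization (lengthMultiset a x b y c) := by
  have H := standard_of_odd y b hx hx1
  rcases ha with ⟨hy, ha⟩ | ⟨hy, ha⟩
  · have := H.join ((standard_of_even x c hy (by omega)).swap.mono (a' := a - x) (by omega))
    convert this using 2 <;> omega
  · have := H.join ((standard_of_odd x c hy (by omega)).swap.mono (a' := a - x) (by omega))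
    convert this using 2 <;> omega

/-! ### Consecutive lengths, the smaller one even -/

namespace Config

variable {x a b c e : ℕ} {P : ℕ → ℕ → Prop}

/-- For even `x`: the rows `{1, …, y}`, `{y + 1, …, 2y}`, … for `y = x + 1`, traversed downwards. -/
theorem rowsDown (hx : x % 2 = 0) (hx0 : 0 < x) (n : ℕ) :
    Config true x (x + 1) x 0 (n * (x + 1) + 1) 0 (n * (x + 1) + 1)
      (fun r s => r = s + 1 ∧ n * (x + 1) + 1 < s ∧ r ≤ n * (x + 1) + 1 + x ∧
        (s + n * (x + 1)) % 2 = 0 ∨ r + (x + 1) = s ∧ s = n * (x + 1) + 1) := by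
  induction n with
  | zero =>
    exact (descending (x + 1) x (by omega)).swap.cast (by omega) rfl (by omega) rfl (by omega)
      (by omega)
  | succ n ih =>
    have e : (n + 1) * (x + 1) = n * (x + 1) + (x + 1) := by ring
    generalize n * (x + 1) = N at *
    rw [e]
    have H := ih.appendY (by omega) rfl (P' := fun r s => r = s + 1 ∧ N + 1 < s ∧ r ≤ N + 1 + x ∧
        (s + N) % 2 = 0 ∨ r + (x + 1) = s ∧ s = N + 1 + (x + 1)) (by omega)
    exact (H.pairsY 1 0 (x / 2) (by omega) (by omega) (by omega) (by omega) (by omega)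
      (P' := fun r s => r = s + 1 ∧ N + (x + 1) + 1 < s ∧ r ≤ N + (x + 1) + 1 + x ∧
        (s + (N + (x + 1))) % 2 = 0 ∨ r + (x + 1) = s ∧ s = N + (x + 1) + 1)
      (by omega)).cast (by omega) (by omega) (by omega) rfl (by omega) (fun _ _ h => h)

/-- If the last `x` vertices are paired up, arbitrarily many pairs can be added by edges of
length `x`. -/
theorem standard_of_window (H : Config false x (x + 1) a b c 0 e P) (hx : x % 2 = 0)
    (hx0 : 0 < x) (hxv : x ≤ a + b + c + 1)
    (hP : ∀ r, (r + (a + b + c + 1)) % 2 = 0 → a + b + c + 1 ≤ r + x → r + 1 < a + b + c + 1 →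
      P r (r + 1)) (m : ℕ) : Standard x (x + 1) a (b + 2 * m) c :=
  (H.pairsX_end 0 1 m (by omega) hx0 hxv (by omega)
    (fun p h1 h2 h3 h4 => hP p (by omega) h1 (by omega))).standard

/-- Pairs of vertices with edges of length `x`, then one `triple`, which shifts the remaining pairs
to where pairs with edges of length `y = x + 1` can be added. The pair recorded in the conclusion is
left for `Config.single`. -/
theorem windowTriple (H : Config false x (x + 1) a b c 0 e P) (hx : x % 2 = 0)
    (hx0 : 0 < x) (hxv : x ≤ a + b + c + 1)
    (hP : ∀ r, (r + (a + b + c + 1)) % 2 = 0 → a + b + c + 1 ≤ r + x → r + 1 < a + b + c + 1 →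
      P r (r + 1)) (m h : ℕ) (hh : 2 * h + 2 ≤ x) :
    Config false x (x + 1) (a + 1) (b + 2 * m + 1) (c + 1 + 2 * h) 0 e
      (fun r s => r + x = a + b + c + 1 + 2 * m + 2 * h + 2 ∧ s = r + 1) := by
  have H1 := H.pairs 0 1 m (by omega) hx0 hxv (by omega)
    (fun p h1 h2 h3 h4 => hP p (by omega) h1 (by omega))
    (P' := fun r s => s = r + 1 ∧ (r + (a + b + c + 1)) % 2 = 0 ∧
      a + b + c + 1 + 2 * m ≤ r + x ∧ s < a + b + c + 1 + 2 * m) (by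
      rintro r s ⟨rfl, h1, h2, h3⟩
      by_cases h4 : r + 1 < a + b + c + 1
      · exact Or.inl ⟨hP r h1 (by omega) h4, by omega⟩
      · right; omega)
  have H2 := H1.triple (p := a + b + c + 1 + 2 * m - x) (by omega) (by omega)
    (P' := fun r s => s = r + 1 ∧ (r + (a + b + c + 1)) % 2 = 0 ∧
      a + b + c + 1 + 2 * m + 2 ≤ r + x ∧ r ≤ a + b + c + 1 + 2 * m) (by omega)
  exact H2.pairsY 0 1 h (by omega) (by omega) (by omega) (by omega) (by omega) (by omega)

theorem standard_of_windowTriple (H : Config false x (x + 1) a b c 0 e P) (hx : x % 2 = 0)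
    (hx0 : 0 < x) (hxv : x ≤ a + b + c + 1)
    (hP : ∀ r, (r + (a + b + c + 1)) % 2 = 0 → a + b + c + 1 ≤ r + x → r + 1 < a + b + c + 1 →
      P r (r + 1)) (m h : ℕ) (hh : 2 * h + 2 ≤ x) :
    Standard x (x + 1) a (b + 2 * m + 2) (c + 2 * h + 2) := by
  have H1 := H.windowTriple hx hx0 hxv hP m h hh
  have H2 := (H1.single (p := a + b + c + 1 + 2 * m + 2 * h + 2 - x) (by omega) (by omega)
    (P' := fun _ _ => False) (fun _ _ h => h.elim)).standard
  convert H2 using 1; omega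

end Config

/-- The case `y = x + 1` with `x` even; the hypothesis covers `{1^x, x, y^c}`. -/
theorem standard_consecutive_of_even {x : ℕ} (hx : x % 2 = 0) (hx0 : 0 < x)
    (h1 : ∀ c, c % (x + 1) % 2 = 1 → Standard x (x + 1) x 1 c) (b c : ℕ) :
    Standard x (x + 1) (x + 1) b c := by
  rcases Nat.eq_zero_or_pos b with rfl | hb
  · exact (standard_of_odd x c (by omega) (by omega)).swap
  rcases Nat.eq_zero_or_pos c with rfl | hc
  · exact (standard_of_even (x + 1) b hx hx0).mono (by omega)
  obtain ⟨n, r, hr, hcn⟩ : ∃ n r, r < x + 1 ∧ c = n * (x + 1) + r :=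
    ⟨c / (x + 1), c % (x + 1), Nat.mod_lt _ (by omega), (Nat.div_add_mod' c _).symm⟩
  have hcr : c % (x + 1) = r := by rw [hcn]; simp [Nat.mod_eq_of_lt hr]
  have D := Config.rowsDown hx hx0 n
  -- the last `x` vertices of a downward row are paired up, only its lowest vertex is not
  have D' := D.toUndirected (P' := fun r s => s = r + 1 ∧ n * (x + 1) + 1 < r ∧
    s ≤ n * (x + 1) + 1 + x ∧ (r + n * (x + 1)) % 2 = 0) (by omega)
  rcases Nat.even_or_odd' b with ⟨m, rfl | rfl⟩ <;> rcases Nat.even_or_odd' r with ⟨k, rfl | rfl⟩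
  · -- `b` and `r` even: the downward rows contain `n * y + 1` edges of length `y`, the wrong
    -- parity; turning the previous row around at its lowest vertex corrects this
    rcases n with _ | n
    · have H := (Config.ascending x (x + 1) (x - 1)).undirected
      have H1 := (H.standard_of_windowTriple hx hx0 (by omega) (by omega) (m - 1) (k - 1)
        (by omega)).mono (a' := x + 1) (by omega)
      convert H1 using 1 <;> omega
    have D := Config.rowsDown hx hx0 n
    have e : (n + 1) * (x + 1) = n * (x + 1) + (x + 1) := by ring
    rw [e] at hcn
    clear D' hcr
    generalize n * (x + 1) = N at *
    have H1 := D.turnDownY (by omega) (by omega) rfl (P' := fun r s => s = r + 1 ∧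
      (N + 3 < r ∧ s ≤ N + 1 + x ∧ (r + N) % 2 = 0 ∨ r = N + x + 3)) (by omega)
    have H2 := H1.pairsY 0 1 (x / 2 - 1) (by omega) (by omega) (by omega) (by omega) (by omega)
      (P' := fun r s => s = r + 1 ∧ N + 3 + x ≤ r ∧ s ≤ N + 2 * x + 2 ∧ (r + N) % 2 = 1) (by omega)
    rcases k with _ | k
    · have H3 := H2.standard_of_window hx hx0 (by omega) (by omega) m
      convert H3 using 1 <;> omega
    · have H3 := H2.standard_of_windowTriple hx hx0 (by omega) (by omega) (m - 1) k (by omega)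
      convert H3 using 1 <;> omega
  · -- `b` even, `r` odd
    clear D hcr
    generalize n * (x + 1) = N at *
    rcases k with _ | k
    · have H3 := (D'.standard_of_window hx hx0 (by omega) (by omega) m).add_one
      convert H3 using 1; omega
    · have H3 := (D'.standard_of_windowTriple hx hx0 (by omega) (by omega) (m - 1) k
        (by omega)).add_one
      convert H3 using 1 <;> omega
  · -- `b` odd, `r` even: `triple` provides one edge of each length; for `r = 0` ascending rows are
    -- used, with all but one vertex of the last row in place
    rcases k with _ | k
    · obtain ⟨n, rfl⟩ : ∃ k, n = k + 1 := ⟨n - 1, by rcases n with _ | n <;> omega⟩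
      have R := Config.rowsY x (y := x + 1) (by omega) n
      have e : (n + 1) * (x + 1) = n * (x + 1) + (x + 1) := by ring
      rw [e] at hcn
      clear D D' hcr
      generalize n * (x + 1) = N at *
      have H1 := (R.pairsY 0 1 (x / 2) (by omega) (by omega) (by omega) (by omega) (by omega)
        (P' := fun r s => s = r + 1 ∧ N + x + 1 ≤ r ∧ s ≤ N + 2 * x ∧ (r + N) % 2 = 1)
        (by omega)).undirected
      have H2 := (H1.windowTriple hx hx0 (by omega) (by omega) m 0 (by omega)).standard
      convert H2 using 1 <;> omega
    · clear D hcr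
      generalize n * (x + 1) = N at *
      have H2 := (D'.windowTriple hx hx0 (by omega) (by omega) m k (by omega)).standard
      convert H2 using 1 <;> omega
  · -- `b` and `r` odd: for `n > 0` the single edge of length `x` comes from `moveLast`
    rcases n with _ | n
    · have H := (Config.ascending x (x + 1) (x - 1)).undirected
      have H1 := (H.windowTriple hx hx0 (by omega) (by omega) m k
        (by omega)).standard.add_one
      convert H1 using 1 <;> omega
    rcases m with _ | m
    · exact (h1 c (by omega)).add_one
    have e : (n + 1) * (x + 1) = n * (x + 1) + (x + 1) := by ring
    rw [e] at hcn D
    clear D' hcr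
    generalize n * (x + 1) = N at *
    have H2 := D.moveLast (p := N + 1) (by omega) (by omega) (by omega) (by omega)
      (P' := fun r s => s = r + 1 ∧ (N + x + 4 < r ∧ s ≤ N + 2 * x + 2 ∧ (r + N) % 2 = 1 ∨
        r = N + 2 * x + 3)) (by omega)
    rcases k with _ | k
    · have H3 := H2.standard_of_window hx hx0 (by omega) (by omega) (m + 1)
      convert H3 using 1; omega
    · have H3 := H2.standard_of_windowTriple hx hx0 (by omega) (by omega) m k (by omega)
      convert H3 using 1 <;> omega

/-! ### Consecutive lengths, the smaller one odd -/

namespace Config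

variable {x a b c e : ℕ} {P : ℕ → ℕ → Prop}

/-- If the last `y` vertices are paired up, `y` even, arbitrarily many pairs can be added by edges
of length `y`. -/
theorem standard_of_windowY (H : Config false x (x + 1) a b c 0 e P) (hx : x % 2 = 1)
    (hxv : x + 1 ≤ a + b + c + 1)
    (hP : ∀ r, (r + (a + b + c + 1)) % 2 = 0 → a + b + c ≤ r + x → r + 1 < a + b + c + 1 →
      P r (r + 1)) (h : ℕ) : Standard x (x + 1) a b (c + 2 * h) :=
  (H.pairsY_end 0 1 h (by omega) (by omega) hxv (by omega)
    (fun p h1 h2 h3 h4 => hP p (by omega) (by omega) (by omega))).standard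

/-- `h` pairs with edges of length `y = x + 1`, then a `single`, after which the remaining pairs
are in place for edges of length `x`. The conclusion records the next of these pairs. -/
theorem windowYSingle (H : Config false x (x + 1) (a + 1) b c 0 e P) (hx : x % 2 = 1)
    (hxv : x ≤ a + b + c + 1)
    (hP : ∀ r, (r + (a + b + c)) % 2 = 0 → a + b + c + 1 ≤ r + x → r < a + b + c + 1 →
      P r (r + 1)) (h g : ℕ) (hg : 2 * g + 1 ≤ x) :
    Config false x (x + 1) a (b + 1 + 2 * g) (c + 1 + 2 * h) 0 e
      (fun r s => s = r + 1 ∧ 2 * g + 3 ≤ x ∧ r + x = a + b + c + 3 + 2 * h + 2 * g) := by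
  have H1 := H.pairsY 0 1 h (by omega) (by omega) (by omega) (by omega)
    (fun p h1 h2 h3 h4 => hP p (by omega) (by omega) (by omega))
    (P' := fun r s => s = r + 1 ∧ (r + (a + b + c)) % 2 = 0 ∧
      a + b + c + 1 + 2 * h ≤ r + x ∧ r < a + b + c + 1 + 2 * h) (by
      rintro r s ⟨rfl, h1, h2, h3⟩
      by_cases h4 : r < a + b + c + 1
      · exact Or.inl ⟨hP r h1 (by omega) h4, by omega⟩
      · right; omega)
  have H2 := H1.single (p := a + b + c + 1 + 2 * h - x) (by omega) (by omega)
    (P' := fun r s => s = r + 1 ∧ (r + (a + b + c)) % 2 = 0 ∧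
      a + b + c + 3 + 2 * h ≤ r + x ∧ r < a + b + c + 1 + 2 * h) (by omega)
  exact (H2.pairs 0 1 g (by omega) (by omega) (by omega) (by omega) (by omega)
    (P' := fun r s => s = r + 1 ∧ 2 * g + 3 ≤ x ∧ r + x = a + b + c + 3 + 2 * h + 2 * g)
    (by omega)).cast rfl rfl (by omega) rfl rfl (fun _ _ h => h)

end Config

/-- The case `y = x + 1` with `x` odd. -/
theorem standard_consecutive_of_odd {x : ℕ} (hx : x % 2 = 1) (hx1 : 1 < x) (b c : ℕ) :
    Standard x (x + 1) (x + 1) b c := by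
  rcases Nat.eq_zero_or_pos b with rfl | hb
  · exact (standard_of_even x c (by omega) (by omega)).swap.mono (by omega)
  rcases Nat.eq_zero_or_pos c with rfl | hc
  · exact (standard_of_odd (x + 1) b hx hx1).mono (by omega)
  obtain ⟨n, r, hr, hbn⟩ : ∃ n r, r < x ∧ b = n * x + r :=
    ⟨b / x, b % x, Nat.mod_lt _ (by omega), (Nat.div_add_mod' b _).symm⟩
  have R := Config.rowsX (x + 1) hx n
  have hn : n = 0 ∨ n * x ≥ x := by
    rcases n with _ | n
    · exact Or.inl rfl
    · right; nlinarith
  have T := fun n => Config.turnedRowX (x + 1) hx hx1 n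
  have hT : ∃ n', n ≠ 0 → n * x = n' * x + x ∧ n = n' + 1 := by
    rcases n with _ | n
    · exact ⟨0, by simp⟩
    · exact ⟨n, fun _ => ⟨by ring, rfl⟩⟩
  -- one more vertex completes the pairing of the last `x + 1` vertices
  have R1 := (R.appendOne (e' := n * x + x) (by omega) (by omega) (P' := fun r s => s = r + 1 ∧
    n * x ≤ r ∧ s < n * x + x + 1 ∧ (r + n * x) % 2 = 0) (by omega)).undirected
  -- if the last `x + 1` vertices are paired up and the parities of the missing numbers `c - c'` and
  -- `r` agree, pairs, one `single` and one `triple` suffice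
  have hcont : ∀ {a b' c' e : ℕ} {P : ℕ → ℕ → Prop}, Config false x (x + 1) (a + 1) b' c' 0 e P →
      x ≤ a + b' + c' + 1 → a ≤ x →
      (∀ r, (r + (a + b' + c')) % 2 = 0 → a + b' + c' + 1 ≤ r + x → r < a + b' + c' + 1 →
        P r (r + 1)) → c' ≤ c → b = b' + r → (c + r + c') % 2 = 0 →
      (c' = c → r = 0) → Standard x (x + 1) (x + 1) b c := by
    intro a b' c' e P H h1 h2 h3 h4 h5 h6 h7
    subst h5
    rcases Nat.even_or_odd' r with ⟨k, rfl | rfl⟩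
    · rcases k with _ | k
      · have H1 := (H.standard_of_windowY hx (by omega) (fun r _ _ _ => h3 r (by omega) (by omega)
          (by omega)) ((c - c') / 2)).mono (a' := x + 1) (by omega)
        convert H1 using 1 <;> omega
      · have H1 := ((H.windowYSingle hx h1 h3 ((c - c' - 2) / 2) k
          (by omega)).triple (p := a + b' + c' + 3 + 2 * ((c - c' - 2) / 2) + 2 * k - x)
          (by omega) (by omega) (P' := fun _ _ => False) (fun _ _ h => h.elim)).standard.mono
            (a' := x + 1) (by omega)
        convert H1 using 1 <;> omega
    · have H1 := (H.windowYSingle hx h1 h3 ((c - c' - 1) / 2) k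
          (by omega)).standard.mono (a' := x + 1) (by omega)
      convert H1 using 1 <;> omega
  by_cases hp : (c + r) % 2 = 0
  · refine hcont (a := x - 1) (c' := 0) (R1.cast (by omega) rfl rfl rfl rfl (fun _ _ h => h))
      (by omega) (by omega) (by omega) (by omega) hbn (by omega) (by omega)
  -- wrong parity: after `x` edges of length `y` the last `x + 1` vertices are paired up again
  by_cases hcx : x < c ∨ x = c ∧ r = 0
  · have H1 := R1.pairsY 0 1 ((x - 1) / 2) (by omega) (by omega) (by omega) (by omega) (by omega)
      (P' := fun r s => s = r + 1 ∧ (r + (n * x)) % 2 = 0 ∧ n * x + x + 1 ≤ r ∧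
        s < n * x + x + x) (by omega)
    have H2 := H1.appendPairY (by omega) rfl (P' := fun r s => s = r + 1 ∧
      (r + (n * x)) % 2 = 0 ∧ n * x + x + 1 ≤ r ∧ s < n * x + x + x + 2) (by omega)
    refine hcont (a := x) (c' := x) (H2.cast (by omega) rfl (by omega) rfl rfl (fun _ _ h => h))
      (by omega) (by omega) (by omega) (by omega) hbn (by omega) (by omega)
  -- without a complete row, the path `0, y, y - 1, …, 1` has the other parity
  rcases hn with rfl | hn
  · have H := (Config.descending (x + 1) x (by omega)).swap.toUndirected (P' := fun r s => s = r + 1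
      ∧ 0 < r ∧ s ≤ x + 1) (by omega)
    by_cases hc1 : c = 1
    · have H1 := (H.pairsX_end 0 1 (b / 2) (by omega) (by omega) (by omega) (by omega)
        (by omega)).standard.mono (a' := x + 1) (by omega)
      convert H1 using 1; omega
    · exact hcont (a := x - 1) (c' := 1) (H.cast (by omega) rfl rfl rfl rfl (fun _ _ h => h))
        (by omega) (by omega) (by omega) (by omega) (by omega) (by omega) (by omega)
  -- a turned row has one edge of length `x` less, and room for `x - 2` more edges
  by_cases hs : r + c ≤ x - 2
  · obtain ⟨n', hn'⟩ := hT
    obtain ⟨hn1, rfl⟩ := hn' (by rintro rfl; omega)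
    have H := T n'
    clear R R1 T hn'
    generalize (n' + 1) * x = M at *
    generalize n' * x = N at *
    subst hn1
    have H1 := H.pairs 0 1 (r / 2) (by omega) (by omega) (by omega) (by omega) (by omega)
      (P' := fun u s => s = u + 1 ∧ (u + N) % 2 = 1 ∧ N + x + 2 * (r / 2) ≤ u ∧
        s < N + x + x) (by omega)
    have H2 := (H1.triple (p := N + x + 2 * (r / 2)) (by omega) (by omega)
      (P' := fun u s => s = u + 1 ∧ (u + N) % 2 = 1 ∧ N + x + 2 * (r / 2) + 2 ≤ u ∧
        s < N + x + x) (by omega)).pairsY 0 1 ((c - 1) / 2) (by omega) (by omega) (by omega)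
      (by omega) (by omega) (P' := fun u s => s = u + 1 ∧ (u + N) % 2 = 1 ∧
        N + x + 2 * (r / 2) + 2 + 2 * ((c - 1) / 2) ≤ u ∧ s < N + x + x) (by omega)
    by_cases hc2 : c % 2 = 0
    · have H3 := (H2.single (p := N + x + 2 * (r / 2) + 2 + 2 * ((c - 1) / 2)) (by omega)
        (by omega) (P' := fun _ _ => False) (fun _ _ h => h.elim)).standard.add_one
      convert H3 using 1 <;> omega
    · have H3 := H2.standard
      convert H3 using 1 <;> omega
  clear hT T hcont
  -- the last row, followed by `2 * m + 1` edges of length `x` and by edges of length `y` to all its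
  -- remaining vertices, the unpaired one included
  have hrow : ∀ m, 2 * m + 3 ≤ x → Config false x (x + 1) x (n * x + 2 * m + 1)
      (x - 1 - 2 * m) 0 (n * x + 2 * x) (fun u s => s = u + 1 ∧ (u + n * x) % 2 = 1 ∧
        n * x + x ≤ u ∧ s < n * x + x + 2 * m + 2) := by
    intro m hm
    generalize n * x = N at *
    have H1 := R.undirected.pairs 0 1 m (by omega) (by omega) (by omega) (by omega) (by omega)
      (P' := fun u s => s = u + 1 ∧ (N + 2 * m ≤ u ∧ s < N + x ∧ (u + N) % 2 = 0 ∨ N + x ≤ u ∧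
        s < N + x + 2 * m ∧ (u + N) % 2 = 1)) (by omega)
    have H2 := H1.triple (p := N + 2 * m) (by omega) (by omega)
      (P' := fun u s => s = u + 1 ∧ (N + 2 * m + 2 ≤ u ∧ s < N + x ∧ (u + N) % 2 = 0 ∨ N + x ≤ u ∧
        s < N + x + 2 * m + 2 ∧ (u + N) % 2 = 1)) (by omega)
    have H3 := H2.pairsY 0 1 ((x - 3) / 2 - m) (by omega) (by omega) (by omega) (by omega)
      (by omega) (P' := fun u s => s = u + 1 ∧ N + x ≤ u ∧
        s < N + x + 2 * m + 2 ∧ (u + N) % 2 = 1) (by omega)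
    exact (H3.appendY (by omega) rfl (fun _ _ h => Or.inl h)).cast (by omega) (by omega) (by omega)
      rfl (by omega) (by omega)
  by_cases hc2 : c % 2 = 0
  · have H1 := (hrow ((r - 1) / 2) (by omega)).pairsY_end 0 1 ((c + r - x) / 2) (by omega)
      (by omega) (by omega) (by omega) (by omega)
    convert H1.standard.add_one using 1 <;> omega
  by_cases hs2 : c + r = x
  · have H1 := (R1.windowYSingle hx (by omega) (by omega) ((c - 1) / 2) (r / 2 - 1)
      (by omega)).appendPairX (by omega) rfl (P' := fun _ _ => False) (fun _ _ h => h.elim)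
    convert H1.standard.mono (a' := x + 1) (by omega) using 1 <;> omega
  · have H1 := (hrow ((r - 2) / 2) (by omega)).pairsY 0 1 ((c + r - x - 2) / 2) (by omega)
      (by omega) (by omega) (by omega) (by omega) (P' := fun u s => s = u + 1 ∧
        u = n * x + x + 2 * ((c + r - x - 2) / 2)) (by omega)
    have H2 := (H1.cast (a' := x - 1 + 1) (by omega) rfl rfl rfl rfl (fun _ _ h => h)).single
      (p := n * x + x + 2 * ((c + r - x - 2) / 2))
      (by omega) (by omega) (P' := fun _ _ => False) (fun _ _ h => h.elim)
    convert H2.standard.mono (a' := x + 1) (by omega) using 1 <;> omega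

/-! ### Many ones, `x` even -/

namespace Config

variable {x y : ℕ}

/-- The edge `q, q - 1` is replaced by an edge of length `x` from `q` to the last vertex. -/
theorem rotateDownX {a b c h e e' : ℕ} {P P' : ℕ → ℕ → Prop}
    (H : Config true x y (a + 1) b c h e P) (hP : P (e' + 1) e') (he' : e' + 1 = e + x)
    (hP' : ∀ r s, P' r s → P s r ∧ ¬(s = e' + 1 ∧ r = e')) :
    Config false x y a (b + 1) c h e' P' := by
  refine (H.rotate (a' := a) (b' := b + 1) (c' := c) hP 0 [] (List.Perm.refl _) (by omega)
    (P' := fun s r => P' r s) ?_ (fun r s hr => Or.inl (hP' s r hr))).toUndirected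
    (fun r s h => Or.inr h)
  have e1 : Nat.dist (e' + 1) e = x := dist_of_add_eq' (by omega)
  have e5 : Nat.dist (e' + 1) e' = 1 := dist_of_add_eq' (by omega)
  simp only [List.nil_append, gaps_cons_cons, gaps_singleton, add_zero, e1,
    e5, singleton_one_eq x y, singleton_left_eq x y, lengthMultiset_add]

end Config

/-- `x` even, `y` and `c % y` odd, `c % y ≥ x - 1`: in the last row, `turnXY` replaces a pair by one
edge of each length, after `x - 2` edges of length `y`. -/
theorem standard_of_odd_mod_high {x y : ℕ} (hx : x % 2 = 0) (hx0 : 0 < x) (hxy : x < y)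
    (hy : y % 2 = 1) (c g : ℕ) (hc : c % y % 2 = 1) (hcx : x ≤ c % y + 1) :
    Standard x y (y - 1) (1 + 2 * g) c := by
  obtain ⟨n, r, hr, hcn⟩ : ∃ n r, r < y ∧ c = n * y + r :=
    ⟨c / y, c % y, Nat.mod_lt _ (by omega), (Nat.div_add_mod' c _).symm⟩
  have hcr : c % y = r := by rw [hcn]; simp [Nat.mod_eq_of_lt hr]
  rw [hcr] at hc hcx
  have R := Config.rowsY x hy n
  clear hcr
  generalize n * y = N at *
  have H1 := R.pairsY 0 1 (x / 2 - 1) (by omega) (by omega) (by omega) (by omega) (by omega)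
    (P' := fun u s => s = u + 1 ∧ (N + x - 2 ≤ u ∧ s < N + y ∧ (u + N) % 2 = 0 ∨
      N + y ≤ u ∧ s < N + y + x - 2 ∧ (u + N) % 2 = 1)) (by omega)
  have H2 := H1.turnXY (q := N + x - 2) (by omega) (by omega) (by omega) rfl
    (P' := fun u s => s = u + 1 ∧ (N + x ≤ u ∧ s < N + y ∧ (u + N) % 2 = 0 ∨
      N + y ≤ u ∧ s < N + y + x ∧ (u + N) % 2 = 1)) (by omega)
  have H3 := H2.pairsY 0 1 ((r + 1 - x) / 2) (by omega) (by omega) (by omega) (by omega)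
    (by omega) (P' := fun u s => s = u + 1 ∧ N + y + (r + 1) ≤ u + x ∧ s < N + y + (r + 1) ∧
      (u + N) % 2 = 1) (by omega)
  have H4 := H3.pairsX_end 0 1 g (by omega) (by omega) (by omega) (by omega) (by omega)
  convert H4.standard using 1; omega

/-- `x` even, `c % y > x`: the last edges of length `y` are added in pairs, which leaves the last
`x` vertices paired up, so that the edges of length `x` can follow. The path they are added to
depends on the parities of `y`, `b` and `c % y`. -/
theorem standard_of_even_of_mod_gt {x y : ℕ} (hx : x % 2 = 0) (hx0 : 0 < x) (hxy : 2 * x < y)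
    (b c : ℕ) (hc : x < c % y)
    (hexc : y % 2 = 1 → c % y % 2 = 0 → b % 2 = 1 → c % y + x < y) :
    Standard x y y b c := by
  obtain ⟨n, r, hr, hcn⟩ : ∃ n r, r < y ∧ c = n * y + r :=
    ⟨c / y, c % y, Nat.mod_lt _ (by omega), (Nat.div_add_mod' c _).symm⟩
  have hcr : c % y = r := by rw [hcn]; simp [Nat.mod_eq_of_lt hr]
  rw [hcr] at hc hexc
  by_cases hy : y % 2 = 0
  · have hcx : x < c := by rw [hcn]; omega
    clear hcn hcr hexc
    -- in every case the last `x` vertices come in pairs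
    have fin : ∀ {a b' c' e : ℕ} {P : ℕ → ℕ → Prop}, Config false x y a b' c' 0 e P → a ≤ y →
        y ≤ a + b' + c' + 1 → c' ≤ 1 → (c + c') % 2 = 0 → b' ≤ 1 → (b + b') % 2 = 0 →
        (∀ u, (u + (a + b' + c' + 1)) % 2 = 0 → a + b' + c' + 1 ≤ u + y → u < a + b' + c' + 1 →
          P u (u + 1)) → Standard x y y b c := by
      intro a b' c' e P H h1 h2 h3 h4 h5 h6 h7
      have H1 := H.pairsY 0 1 ((c - c') / 2) (by omega) (by omega) (by omega) (by omega)
        (fun p _ _ _ _ => h7 p (by omega) (by omega) (by omega)) (P' := fun u s => s = u + 1 ∧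
          (u + (a + b' + c' + 1)) % 2 = 0 ∧ a + b' + c + 1 ≤ u + x ∧
          u < a + b' + c + 1) (by omega)
      have H2 := H1.pairsX_end 0 1 ((b - b') / 2) (by omega) (by omega) (by omega) (by omega)
        (by omega)
      convert H2.standard.mono h1 using 1 <;> omega
    have A := Config.ascending x y (y - 1)
    have D := (Config.descending y x (by omega)).swap
    rcases Nat.mod_two_eq_zero_or_one b with hb | hb <;>
      rcases Nat.mod_two_eq_zero_or_one c with hc2 | hc2
    · exact fin A.undirected (by omega) (by omega) (by omega) (by omega) (by omega) (by omega)
        (by omega)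
    · exact fin (D.toUndirected (P' := fun u s => s = u + 1 ∧ 0 < u ∧ s ≤ y) (by omega)) (by omega)
        (by omega) (by omega) (by omega) (by omega) (by omega) (by omega)
    · exact fin ((A.cast (a' := y - 2 + 1) (by omega) rfl rfl rfl rfl (fun _ _ h => h)).rotateX
        (q := y - 1 - x) (by omega) (by omega) rfl (P' := fun u s => s = u + 1 ∧ s ≤ y - 1 ∧
          u % 2 = 0) (by omega)) (by omega)
        (by omega) (by omega) (by omega) (by omega) (by omega) (by omega)
    · exact fin ((D.cast (a' := y - 2 + 1) (by omega) rfl rfl rfl rfl (fun _ _ h => h)).rotateDownX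
        (e' := x) (by omega) (by omega) (P' := fun u s => s = u + 1 ∧ 0 < u ∧ s ≤ y ∧
          u % 2 = 1) (by omega)) (by omega)
        (by omega) (by omega) (by omega) (by omega) (by omega) (by omega)
  rcases Nat.mod_two_eq_zero_or_one r with hr2 | hr2
  · have R := Config.rowsY x (y := y) (by omega) n
    clear hcr
    generalize n * y = N at *
    rcases Nat.mod_two_eq_zero_or_one b with hb | hb
    · have H1 := R.pairsY 0 1 (r / 2) (by omega) (by omega) (by omega) (by omega) (by omega)
        (P' := fun u s => s = u + 1 ∧ N + y + r ≤ u + x ∧ s < N + y + r ∧ (u + N) % 2 = 1)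
        (by omega)
      have H2 := H1.pairsX_end 0 1 (b / 2) (by omega) (by omega) (by omega) (by omega) (by omega)
      convert H2.standard.mono (a' := y) (by omega) using 1 <;> omega
    · have H0 := (R.cast (a' := y - 2 + 1) (by omega) rfl rfl rfl rfl (fun _ _ h => h)).rotateX
        (q := N + (y - 1 - x)) (by omega) (by omega) rfl (P' := fun u s => s = u + 1 ∧ N ≤ u ∧
          s < N + (y - 1 - x) ∧ (u + N) % 2 = 0) (by omega)
      have H1 := H0.pairsY 0 1 (r / 2) (by omega) (by omega) (by omega) (by omega) (by omega)
        (P' := fun u s => s = u + 1 ∧ N + y + r ≤ u + x ∧ s < N + y + r ∧ (u + N) % 2 = 1)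
        (by omega)
      have H2 := H1.pairsX_end 0 1 (b / 2) (by omega) (by omega) (by omega) (by omega) (by omega)
      convert H2.standard.mono (a' := y) (by omega) using 1 <;> omega
  · -- for even `b` the last row is turned, for odd `b` there is `turnXY`
    rcases Nat.mod_two_eq_zero_or_one b with hb | hb
    · rcases n with _ | n
      · have D := (Config.descending y x (by omega)).swap.toUndirected
          (P' := fun u s => s = u + 1 ∧ 0 < u ∧ s ≤ y) (by omega)
        have H1 := D.pairsY 0 1 (r / 2) (by omega) (by omega) (by omega) (by omega) (by omega)
          (P' := fun u s => s = u + 1 ∧ y + r ≤ u + x ∧ s < y + r ∧ u % 2 = 0) (by omega)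
        have H2 := H1.pairsX_end 0 1 (b / 2) (by omega) (by omega) (by omega) (by omega) (by omega)
        convert H2.standard.mono (a' := y) (by omega) using 1 <;> omega
      · have T := Config.turnedRowY x (y := y) (by omega) (by omega) n
        have e : (n + 1) * y = n * y + y := by ring
        rw [e] at hcn
        clear hcr
        generalize n * y = N at *
        have H1 := T.pairsY 0 1 ((r + 1) / 2) (by omega) (by omega) (by omega) (by omega)
          (by omega) (P' := fun u s => s = u + 1 ∧ N + y + y + r + 1 ≤ u + x ∧
            s < N + y + y + r + 1 ∧ (u + N) % 2 = 0) (by omega)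
        have H2 := H1.pairsX_end 0 1 (b / 2) (by omega) (by omega) (by omega) (by omega) (by omega)
        convert H2.standard.mono (a' := y) (by omega) using 1 <;> omega
    · have H := (standard_of_odd_mod_high (y := y) hx hx0 (by omega) (by omega) c (b / 2)
        (by omega) (by omega)).mono (a' := y) (by omega)
      convert H using 1; omega

/-! ### Weaving columns -/

/-- Concatenation of two paths by an edge. -/
theorem gaps_append {s t : List ℕ} {p q : ℕ} (hs : s.getLast? = some p) (ht : t.head? = some q) :
    gaps (s ++ t) = gaps s + {Nat.dist p q} + gaps t := by
  obtain ⟨s, rfl⟩ := List.getLast?_eq_some_iff.1 hs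
  obtain ⟨t, rfl⟩ := List.head?_eq_some_iff.1 ht
  rw [List.append_assoc, List.singleton_append, gaps_append_cons_cons]

/-- The vertices `j, j + y, …, j + n * y`. -/
def column (y n j : ℕ) : List ℕ := (List.range (n + 1)).map fun t => j + t * y

/-- The columns listed in `w`, traversed alternately upwards and downwards; the first one is
traversed upwards if `up` is `true`. -/
def weave (y n : ℕ) : Bool → List ℕ → List ℕ
  | _, [] => []
  | true, j :: w => column y n j ++ weave y n false w
  | false, j :: w => (column y n j).reverse ++ weave y n true w

theorem column_succ (y n j : ℕ) : column y (n + 1) j = column y n j ++ [j + (n + 1) * y] := by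
  simp [column, List.range_succ]

theorem head?_column (y n j : ℕ) : (column y n j).head? = some j := by
  simp [column, List.range_succ_eq_map]

theorem getLast?_column (y n j : ℕ) : (column y n j).getLast? = some (j + n * y) := by
  simp [column, List.range_succ]

theorem gaps_column (y n j : ℕ) : gaps (column y n j) = Multiset.replicate n y := by
  induction n with
  | zero => rfl
  | succ n ih =>
    rw [column_succ, gaps_append (getLast?_column y n j) (q := j + (n + 1) * y) rfl, ih,
      dist_of_add_eq (d := y) (by ring), Multiset.replicate_succ,
      gaps_singleton, add_zero, add_comm, Multiset.singleton_add]

/-- The direction of the first column of `t` depends on the parity of the number of columns of `s`.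
-/
theorem weave_append (y n : ℕ) (up : Bool) (s t : List ℕ) :
    weave y n up (s ++ t) = weave y n up s ++ weave y n (xor up (s.length % 2 == 1)) t := by
  induction s generalizing up with
  | nil => cases up <;> rfl
  | cons j s ih =>
    rcases Nat.mod_two_eq_zero_or_one s.length with h | h <;> cases up <;>
      simp [weave, ih, Nat.add_mod, h]

theorem head?_weave_true (y n j : ℕ) (w : List ℕ) :
    (weave y n true (j :: w)).head? = some j := by
  simp [weave, head?_column]

theorem head?_weave_false (y n j : ℕ) (w : List ℕ) :
    (weave y n false (j :: w)).head? = some (j + n * y) := by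
  simp [weave, List.head?_reverse, getLast?_column]

theorem getLast?_weave_bottom (y n j : ℕ) (up : Bool) (w : List ℕ)
    (h : xor up (w.length % 2 == 1) = false) :
    (weave y n up (w ++ [j])).getLast? = some j := by
  simp [weave_append, h, weave, List.getLast?_reverse, head?_column]

theorem getLast?_weave_top (y n j : ℕ) (up : Bool) (w : List ℕ)
    (h : xor up (w.length % 2 == 1) = true) :
    (weave y n up (w ++ [j])).getLast? = some (j + n * y) := by
  simp [weave_append, h, weave, getLast?_column]

/-- Neighbouring columns of equal height are at the same distance at the top and at the bottom. -/
theorem gaps_weave (y n : ℕ) (up : Bool) (w : List ℕ) :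
    gaps (weave y n up w) = Multiset.replicate (w.length * n) y + gaps w := by
  induction w generalizing up with
  | nil => cases up <;> simp [weave]
  | cons j w ih =>
    cases w with
    | nil => cases up <;> simp [weave, gaps_reverse, gaps_column]
    | cons k w =>
      cases up
      · have e : weave y n false (j :: k :: w) =
            (column y n j).reverse ++ weave y n true (k :: w) := rfl
        rw [e, gaps_append (p := j) (by rw [List.getLast?_reverse, head?_column])
          (head?_weave_true _ _ _ _), ih, gaps_reverse, gaps_column, gaps_cons_cons,
          List.length_cons (a := j), add_mul, one_mul, Multiset.replicate_add]
        abel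
      · have e : weave y n true (j :: k :: w) = column y n j ++ weave y n false (k :: w) := rfl
        have e2 : Nat.dist (j + n * y) (k + n * y) = Nat.dist j k := by unfold Nat.dist; omega
        rw [e, gaps_append (getLast?_column _ _ _) (head?_weave_false _ _ _ _), ih, gaps_column,
          gaps_cons_cons, e2, List.length_cons (a := j), add_mul, one_mul, Multiset.replicate_add]
        abel

theorem weave_perm (y n : ℕ) (up : Bool) (w : List ℕ) :
    (weave y n up w).Perm (w.flatMap (column y n)) := by
  induction w generalizing up with
  | nil => cases up <;> exact List.Perm.refl _
  | cons j w ih =>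
    cases up
    · exact (List.reverse_perm _).append (ih _)
    · exact (ih _).append_left _

/-- Raising all columns by one vertex adds a row. -/
theorem flatMap_column_succ (y n : ℕ) (w : List ℕ) :
    (w.flatMap (column y (n + 1))).Perm
      (w.flatMap (column y n) ++ w.map (· + (n + 1) * y)) := by
  have h : column y (n + 1) = fun j => column y n j ++ [j + (n + 1) * y] :=
    funext (column_succ y n)
  rw [h]
  refine (List.flatMap_append_perm w _ _).symm.trans ?_
  rw [← List.map_eq_flatMap]

theorem flatMap_column_range (y n : ℕ) :
    ((List.range y).flatMap (column y n)).Perm (List.range ((n + 1) * y)) := by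
  induction n with
  | zero =>
    have : column y 0 = fun j => [j] := by funext j; simp [column]
    rw [this, ← List.map_eq_flatMap]; simp
  | succ n ih =>
    refine (flatMap_column_succ y n _).trans ?_
    rw [show (n + 1 + 1) * y = (n + 1) * y + y by ring, List.range_add]
    simp_rw [add_comm _ ((n + 1) * y)]
    exact ih.append_right _

/-- The columns of `(n + 1) * y + r` vertices: `r` tall ones and `y - r` short ones. -/
theorem flatMap_columns_perm {y n r : ℕ} (hr : r ≤ y) {w₁ w₂ : List ℕ}
    (h₁ : w₁.Perm (List.range r)) (h₂ : w₂.Perm (List.range' r (y - r))) :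
    (w₁.flatMap (column y (n + 1)) ++ w₂.flatMap (column y n)).Perm
      (List.range ((n + 1) * y + r)) := by
  have e : List.range y = List.range r ++ List.range' r (y - r) := by
    rw [List.range_eq_range', List.range_eq_range']
    conv_lhs => rw [show y = r + (y - r) by omega, ← List.range'_append_1]
    simp
  refine (((flatMap_column_succ y n w₁).append_right _).trans ?_)
  rw [List.range_add]
  refine List.Perm.trans ?_ ((flatMap_column_range y n).append_right _)
  rw [e, List.flatMap_append]
  have p1 := h₁.flatMap_right (column y n)
  have p2 := h₂.flatMap_right (column y n)
  have p3 := h₁.map (· + (n + 1) * y)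
  simp_rw [add_comm _ ((n + 1) * y)] at p3 ⊢
  refine List.Perm.trans ?_ ((p1.append p2).append p3)
  rw [List.append_assoc, List.append_assoc]
  exact List.perm_append_comm.append_left _

theorem replicate_one_eq (x y n : ℕ) : Multiset.replicate n 1 = lengthMultiset n x 0 y 0 := by
  simp [lengthMultiset]

theorem replicate_right_eq (x y n : ℕ) : Multiset.replicate n y = lengthMultiset 0 x 0 y n := by
  simp [lengthMultiset]

/-- A path on `s, …, s + n - 1` that starts at `s` and has `o` edges of length `1` and otherwise
edges of length `x`. -/
theorem exists_arc_up {x : ℕ} (y : ℕ) (hx : x % 2 = 0) (hx0 : 0 < x) (s n o : ℕ) (ho : o < n)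
    (hox : x ≤ o + 1 ∨ o + 1 = n) : ∃ t : List ℕ, (s :: t).Perm (List.range' s n) ∧
      gaps (s :: t) = lengthMultiset o x (n - 1 - o) y 0 := by
  have H : Standard x y o (n - 1 - o) 0 := by
    rcases hox with h | h
    · exact (standard_of_even y _ hx hx0).mono (by omega)
    · rw [show n - 1 - o = 0 by omega]; exact (Config.ascending x y o).standard
  obtain ⟨l, h1, h2, h3⟩ := H
  obtain ⟨t, rfl⟩ := List.head?_eq_some_iff.1 h3
  refine ⟨t.map (s + ·), ?_, ?_⟩
  · have := h1.map (s + ·)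
    rw [show o + (n - 1 - o) + 0 + 1 = n by omega] at this
    rw [List.range'_eq_map_range]; simpa using this
  · rw [← h2, ← gaps_map (s + ·) (0 :: t) (fun p _ q _ => by unfold Nat.dist; omega)]
    rfl

/-- A path on `s, …, s + n` that starts at `s + n` and has `o` edges of length `1` and otherwise
edges of length `x`. -/
theorem exists_arc_down {x : ℕ} (y : ℕ) (hx : x % 2 = 0) (hx0 : 0 < x) (s n o : ℕ) (ho : o ≤ n)
    (hox : x ≤ o + 1 ∨ o = n) : ∃ t : List ℕ, ((s + n) :: t).Perm (List.range' s (n + 1)) ∧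
      gaps ((s + n) :: t) = lengthMultiset o x (n - o) y 0 := by
  obtain ⟨t, h1, h2⟩ := exists_arc_up y hx hx0 0 (n + 1) o (by omega) (by omega)
  rw [← List.range_eq_range'] at h1
  have h3 := (perm_reflect h1).map (s + ·)
  rw [← List.range'_eq_map_range, List.map_map] at h3
  refine ⟨t.map ((s + ·) ∘ (n + 1 - 1 - ·)), by simpa using h3, ?_⟩
  rw [show (s + n) :: t.map ((s + ·) ∘ (n + 1 - 1 - ·)) =
    (0 :: t).map ((s + ·) ∘ (n + 1 - 1 - ·)) by simp, gaps_map, h2]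
  · rfl
  · intro p hp q hq
    have := List.mem_range.1 (h1.mem_iff.1 hp)
    have := List.mem_range.1 (h1.mem_iff.1 hq)
    simp only [Function.comp]; unfold Nat.dist; omega

theorem mod_decomp {y : ℕ} (hy : 0 < y) (c : ℕ) :
    ∃ n r, r < y ∧ c = n * y + r ∧ c % y = r :=
  ⟨c / y, c % y, Nat.mod_lt _ hy, (Nat.div_add_mod' c _).symm, rfl⟩

theorem exists_config_of_list {x y a b c h : ℕ} {P : ℕ → ℕ → Prop} {l : List ℕ}
    (h1 : l.Perm (List.range (a + b + c + 1))) (h2 : gaps l = lengthMultiset a x b y c)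
    (h3 : l.head? = some h) (h4 : ∀ p q, P p q → Nb false l p q) :
    ∃ e, Config false x y a b c h e P := by
  cases hl : l.getLast? with
  | none => rw [List.getLast?_eq_none_iff] at hl; simp [hl] at h3
  | some e => exact ⟨e, l, h1, h2, h3, hl, h4⟩

theorem pair_infix_weave_top (y n j k : ℕ) (w : List ℕ) :
    [j + n * y, k + n * y] <:+: weave y n true (j :: k :: w) := by
  have e : weave y n true (j :: k :: w) = column y n j ++ weave y n false (k :: w) := rfl
  rw [e, pair_infix_append]
  exact Or.inr (Or.inr ⟨getLast?_column _ _ _, head?_weave_false _ _ _ _⟩)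

theorem pair_infix_weave_bottom (y n j k : ℕ) (w : List ℕ) :
    [j, k] <:+: weave y n false (j :: k :: w) := by
  have e : weave y n false (j :: k :: w) = (column y n j).reverse ++ weave y n true (k :: w) := rfl
  rw [e, pair_infix_append]
  exact Or.inr (Or.inr ⟨by rw [List.getLast?_reverse, head?_column], head?_weave_true _ _ _ _⟩)

/-- `c % y` even: the tall columns in increasing order, then the short ones. Since the number of
tall columns is even, the change to the short ones takes place at the bottom. The recorded pair
consists of the tops of the columns `0` and `1`. -/
theorem exists_config_weave_of_even_mod {x y : ℕ} (hx : x % 2 = 0) (hx0 : 0 < x) (hxy : x < y)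
    (A c : ℕ) (hc : c % y % 2 = 0) (hA : A < y) (hA' : x + c % y ≤ A + 1 ∨ A + 1 = y) :
    ∃ e, Config false x y A (y - 1 - A) c 0 e
      (fun p q => q = p + 1 ∧ 2 ≤ c % y ∧ q + c % y = y + c + 1) := by
  obtain ⟨n, r, hr, hcn, hcr⟩ := mod_decomp (y := y) (by omega) c
  rw [hcr] at hc hA' ⊢
  obtain ⟨t, ht1, ht2⟩ := exists_arc_up y hx hx0 r (y - r) (A - r) (by omega) (by omega)
  have hlen : (r :: t).length = y - r := by rw [ht1.length_eq]; simp
  have hperm := ((weave_perm y (n + 1) true (List.range r)).append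
    (weave_perm y n true (r :: t))).trans (flatMap_columns_perm hr.le (List.Perm.refl _) ht1)
  have hv : A + (y - 1 - A) + c + 1 = (n + 1) * y + r := by rw [add_mul, hcn]; omega
  rw [← hv] at hperm
  refine exists_config_of_list (l := weave y (n + 1) true (List.range r) ++ weave y n true (r :: t))
    hperm ?_ ?_ ?_
  · rcases r with _ | k
    · rw [show weave y (n + 1) true (List.range 0) = [] from rfl, List.nil_append, gaps_weave,
        ht2, hlen, replicate_right_eq x y, lengthMultiset_add]
      have e : (y - 0) * n = n * y := by rw [Nat.sub_zero, mul_comm]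
      rw [e]
      congr 1 <;> omega
    · have hl : (weave y (n + 1) true (List.range (k + 1))).getLast? = some k := by
        rw [List.range_succ]
        apply getLast?_weave_bottom
        have : k % 2 = 1 := by omega
        simp [this]
      rw [gaps_append hl (head?_weave_true _ _ _ _), gaps_weave, gaps_weave, ht2, hlen,
        List.range_eq_range', gaps_range', dist_of_add_eq (d := 1) rfl]
      simp only [List.length_range', replicate_one_eq x y, replicate_right_eq x y,
        singleton_one_eq x y, lengthMultiset_add]
      have e : (k + 1) * (n + 1) + (y - (k + 1)) * n = n * y + (k + 1) := by
        obtain ⟨m, rfl⟩ : ∃ m, y = k + 1 + m := ⟨y - (k + 1), by omega⟩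
        rw [Nat.add_sub_cancel_left]; ring
      congr 1 <;> omega
  · rcases r with _ | k
    · exact head?_weave_true _ _ _ _
    · rw [List.range_succ_eq_map, List.head?_append, head?_weave_true]; rfl
  · rintro p q ⟨rfl, h2, h3⟩
    obtain ⟨k, rfl⟩ : ∃ k, r = k + 2 := ⟨r - 2, by omega⟩
    have hp : p = 0 + (n + 1) * y := by rw [add_mul]; omega
    have hp' : p + 1 = 1 + (n + 1) * y := by omega
    obtain ⟨u, hu⟩ : ∃ u, List.range (k + 2) = 0 :: 1 :: u := ⟨List.range' 2 k, by
      rw [List.range_eq_range', List.range'_succ, List.range'_succ]⟩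
    have := pair_infix_weave_top y (n + 1) 0 1 u
    rw [← hu, ← hp, ← hp'] at this
    exact Or.inl (this.trans (List.infix_append' [] _ _))

theorem standard_weave_of_even_mod {x y : ℕ} (hx : x % 2 = 0) (hx0 : 0 < x) (hxy : x < y)
    (A c : ℕ) (hc : c % y % 2 = 0) (hA : A < y) (hA' : x + c % y ≤ A + 1 ∨ A + 1 = y) :
    Standard x y A (y - 1 - A) c :=
  (exists_config_weave_of_even_mod hx hx0 hxy A c hc hA hA').choose_spec.standard

/-- `y` odd, `c % y` even: up the column `0`, from its top to the top of the column `y - 1`, which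
is an edge of length `1`, then the short columns in decreasing order and the remaining tall ones.
-/
theorem standard_weave_of_even_mod_of_odd {x y : ℕ} (hx : x % 2 = 0) (hx0 : 0 < x)
    (hy : y % 2 = 1) (A c : ℕ) (hc : c % y % 2 = 0) (hc0 : 0 < c % y) (hA : A < y)
    (hA' : x + y ≤ A + c % y) :
    Standard x y A (y - 1 - A) c := by
  obtain ⟨n, r, hr, hcn, hcr⟩ := mod_decomp (y := y) (by omega) c
  rw [hcr] at hc hA' hc0
  obtain ⟨k, rfl⟩ : ∃ k, r = k + 2 := ⟨r - 2, by omega⟩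
  obtain ⟨m, rfl⟩ : ∃ m, y = k + 2 + m + 1 := ⟨y - k - 3, by omega⟩
  set y := k + 2 + m + 1 with hy'
  obtain ⟨t, ht1, ht2⟩ := exists_arc_down y hx hx0 1 k (A + k + 2 - y - 1) (by omega) (by omega)
  set w := (List.range' (k + 2) (m + 1)).reverse with hw
  have hlw : w.length = m + 1 := by simp [hw]
  have hlen : ((1 + k) :: t).length = k + 1 := by rw [ht1.length_eq]; simp
  have hw1 : w = (k + 2 + m) :: (List.range' (k + 2) m).reverse := by
    rw [hw, List.range'_concat]; simp
  have hw2 : w = (List.range' (k + 3) m).reverse ++ [k + 2] := by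
    rw [hw, List.range'_succ]; simp
  have h0 : (0 :: (1 + k) :: t).Perm (List.range (k + 2)) := by
    rw [List.range_eq_range', List.range'_succ]; exact ht1.cons 0
  have hperm := flatMap_columns_perm (n := n) (w₂ := w) hr.le h0 (by
    rw [show y - (k + 2) = m + 1 by omega]; exact List.reverse_perm _)
  refine ⟨column y (n + 1) 0 ++ (weave y n false w ++ weave y (n + 1) true ((1 + k) :: t)),
    ?_, ?_, ?_⟩
  · have : A + (y - 1 - A) + c + 1 = (n + 1) * y + (k + 2) := by rw [add_mul, hcn]; omega
    rw [this]
    refine List.Perm.trans ?_ hperm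
    rw [List.flatMap_cons, List.append_assoc]
    refine List.Perm.append_left _ (List.perm_append_comm.trans ?_)
    exact (weave_perm _ _ _ _).append (weave_perm _ _ _ _)
  · have l1 : (weave y n false w).getLast? = some (k + 2) := by
      rw [hw2]
      apply getLast?_weave_bottom
      have : m % 2 = 0 := by omega
      simp [this]
    have l2 : (weave y n false w ++ weave y (n + 1) true ((1 + k) :: t)).head? =
        some (k + 2 + m + n * y) := by
      rw [hw1, List.head?_append, head?_weave_false]; rfl
    have d1 : Nat.dist (0 + (n + 1) * y) (k + 2 + m + n * y) = 1 :=
      dist_of_add_eq' (by rw [add_mul]; omega)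
    rw [gaps_append (getLast?_column _ _ _) l2, gaps_append l1 (head?_weave_true _ _ _ _), d1,
      gaps_weave, gaps_weave, gaps_column, hlw, hlen, ht2, hw, gaps_reverse, gaps_range',
      dist_of_add_eq' (p := k + 2) (q := 1 + k) (d := 1) (by omega)]
    simp only [replicate_one_eq x y, replicate_right_eq x y, singleton_one_eq x y,
      lengthMultiset_add]
    have e : n + 1 + ((m + 1) * n + (k + 1) * (n + 1)) = n * y + (k + 2) := by rw [hy']; ring
    congr 1 <;> omega
  · rw [List.head?_append, head?_column]; rfl

/-- `c % y < x` odd: the column `0` without its topmost vertex, the columns `x, x - 1, …, 1`, the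
topmost vertex of column `0`, and the remaining columns. That vertex is at the height of the tops of
the short columns and acts as the top of a column `y`. -/
theorem standard_weave_of_odd_mod {x y : ℕ} (hx : x % 2 = 0) (hxy : x < y)
    (A c : ℕ) (hc : c % y % 2 = 1) (hcx : c % y < x) (hA : A < y)
    (hA' : 2 * x ≤ A + 1 ∨ A + 1 = y) :
    Standard x y A (y - A) c := by
  obtain ⟨n, r, hr, hcn, hcr⟩ := mod_decomp (y := y) (by omega) c
  rw [hcr] at hc hcx
  obtain ⟨k, rfl⟩ : ∃ k, r = k + 1 := ⟨r - 1, by omega⟩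
  obtain ⟨m, rfl⟩ : ∃ m, x = k + 2 + m := ⟨x - (k + 2), by omega⟩
  set x := k + 2 + m with hx'
  obtain ⟨p, rfl⟩ : ∃ p, y = x + 1 + p := ⟨y - x - 1, by omega⟩
  set y := x + 1 + p with hy'
  obtain ⟨t, ht1, ht2⟩ := exists_arc_down y hx (by omega) (x + 1) p (A - x) (by omega) (by omega)
  have ht3 : t.Perm (List.range' (x + 1) p) := by
    rw [List.range'_concat, one_mul] at ht1
    exact (List.perm_cons _).1 (ht1.trans (List.perm_append_singleton _ _))
  set w := (List.range' (k + 2) (m + 1)).reverse with hw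
  set u := (List.range' 1 (k + 1)).reverse with hu
  have hlw : w.length = m + 1 := by simp [hw]
  have hlu : u.length = k + 1 := by simp [hu]
  have hlen : t.length = p := by rw [ht3.length_eq]; simp
  have hw1 : w = x :: (List.range' (k + 2) m).reverse := by
    rw [hw, List.range'_concat]; simp [hx']
  have hw2 : 0 :: w = (0 :: (List.range' (k + 3) m).reverse) ++ [k + 2] := by
    rw [hw, List.range'_succ]; simp
  have hu1 : u = (k + 1) :: (List.range' 1 k).reverse := by
    rw [hu, List.range'_concat]; simp [add_comm]
  have hu2 : u = (List.range' 2 k).reverse ++ [1] := by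
    rw [hu, List.range'_succ]; simp
  -- `(n + 1) * y = y + n * y` is the top of the fictitious column `y`
  have gt : gaps ((n + 1) * y :: weave y n false t) =
      lengthMultiset (A - x) x (p - (A - x)) y (p * n) := by
    cases t with
    | nil =>
      have : p = 0 := by simpa using hlen.symm
      subst this
      simpa [weave] using ht2
    | cons j t =>
      have d : Nat.dist ((n + 1) * y) (j + n * y) = Nat.dist (x + 1 + p) j := by
        rw [add_mul, one_mul, ← hy']; unfold Nat.dist; omega
      have := gaps_append (s := [(n + 1) * y]) (p := (n + 1) * y) rfl (head?_weave_false y n j t)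
      rw [d, gaps_weave, hlen, gaps_singleton, zero_add] at this
      rw [gaps_cons_cons] at ht2
      calc _ = {Nat.dist (x + 1 + p) j} + (Multiset.replicate (p * n) y + gaps (j :: t)) := this
        _ = ({Nat.dist (x + 1 + p) j} + gaps (j :: t)) + Multiset.replicate (p * n) y := by abel
        _ = _ := by
          rw [ht2, replicate_right_eq x y, lengthMultiset_add]
          congr 1; omega
  refine ⟨weave y n true (0 :: w) ++ (weave y (n + 1) true u ++
    ((n + 1) * y :: weave y n false t)), ?_, ?_, ?_⟩
  · have : A + (y - A) + c + 1 = (n + 1) * y + (k + 2) := by rw [add_mul, hcn]; omega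
    rw [this]
    have h0 : (0 :: u).Perm (List.range (k + 2)) := by
      rw [List.range_eq_range', List.range'_succ]; exact (List.reverse_perm _).cons 0
    have h1 : (w ++ t).Perm (List.range' (k + 2) (y - (k + 2))) := by
      rw [show y - (k + 2) = (m + 1) + p by omega, ← List.range'_append_1,
        show k + 2 + (m + 1) = x + 1 by omega]
      exact (List.reverse_perm _).append ht3
    refine List.Perm.trans ?_ (flatMap_columns_perm (n := n) (by omega) h0 h1)
    have q1 := weave_perm y n true (0 :: w)
    have q2 := weave_perm y (n + 1) true u
    have q3 := weave_perm y n false t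
    refine (q1.append (q2.append (q3.cons _))).trans ?_
    rw [List.perm_iff_count]
    intro z
    simp only [List.flatMap_cons, column_succ y n 0, List.flatMap_append, List.count_append,
      List.count_cons, List.count_nil, zero_add]
    omega
  · have l1 : (weave y n true (0 :: w)).getLast? = some (k + 2) := by
      rw [hw2]
      apply getLast?_weave_bottom
      have : (m + 1) % 2 = 1 := by omega
      simp [this]
    have l2 : (weave y (n + 1) true u ++ ((n + 1) * y :: weave y n false t)).head? =
        some (k + 1) := by
      rw [hu1, List.head?_append, head?_weave_true]; rfl
    have l3 : (weave y (n + 1) true u).getLast? = some (1 + (n + 1) * y) := by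
      rw [hu2]
      apply getLast?_weave_top
      have : k % 2 = 0 := by omega
      simp [this]
    have gw : gaps (0 :: w) = lengthMultiset m x 1 y 0 := by
      have : gaps w = lengthMultiset m x 0 y 0 := by
        rw [hw, gaps_reverse, gaps_range', replicate_one_eq x y]
      rw [hw1] at this ⊢
      rw [gaps_cons_cons, this, dist_of_add_eq (d := x) (by omega), singleton_left_eq x y,
        lengthMultiset_add, zero_add]
    rw [gaps_append l1 l2, gaps_append l3 (q := (n + 1) * y) rfl, gt, gaps_weave, gaps_weave,
      List.length_cons, hlw, hlu, gw, hu, gaps_reverse, gaps_range',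
      dist_of_add_eq' (p := k + 2) (q := k + 1) (d := 1) rfl,
      dist_of_add_eq' (p := 1 + (n + 1) * y) (d := 1) (by omega)]
    simp only [replicate_one_eq x y, replicate_right_eq x y, singleton_one_eq x y,
      lengthMultiset_add]
    have e : (m + 1 + 1) * n + (k + 1) * (n + 1) + p * n = n * y + (k + 1) := by
      rw [hy', hx']; ring
    congr 1 <;> omega
  · rw [List.head?_append, head?_weave_true]; rfl

/-! ### Many ones, `x` even or `y = x + 1` -/

/-- Two paths are glued: one with the lengths `1`, `x` and one with the lengths `1`, `y`. If `y` and
`c % y` are odd, the latter may need `y` ones; one edge of length `x` is then used to save a one. -/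
theorem hasLinearRealization_of_even {x y : ℕ} (hx : x % 2 = 0) (hx0 : 0 < x) (hxy : x < y)
    {a : ℕ} (b c : ℕ) (ha : x + y - 2 ≤ a) :
    HasLinearRealization (lengthMultiset a x b y c) := by
  have H := standard_of_even y b hx hx0
  rcases Nat.mod_two_eq_zero_or_one y with hy | hy
  · have := H.join ((standard_of_even x c hy (by omega)).swap.mono (a' := a - (x - 1)) (by omega))
    convert this using 2 <;> omega
  rcases Nat.mod_two_eq_zero_or_one (c % y) with hc | hc
  · have := H.join ((standard_weave_of_even_mod hx hx0 hxy (y - 1) c hc (by omega)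
      (by omega)).mono (a' := a - (x - 1)) (by omega))
    convert this using 2 <;> omega
  rcases b with _ | b
  · exact ((standard_of_odd x c hy (by omega)).swap.mono (by omega)).hasLinearRealization
  have H1 : Standard x y (y - 1) 1 c := by
    by_cases hcx : c % y < x
    · have := standard_weave_of_odd_mod hx hxy (y - 1) c hc hcx (by omega) (by omega)
      convert this using 1; omega
    · exact standard_of_odd_mod_high hx hx0 hxy hy c 0 hc (by omega)
  have := (standard_of_even y b hx hx0).join (H1.mono (a' := a - (x - 1)) (by omega))
  convert this using 2 <;> omega

theorem hasLinearRealization_consecutive {x a : ℕ} (hx1 : 1 < x) (b c : ℕ) (ha : x + 1 ≤ a) :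
    HasLinearRealization (lengthMultiset a x b (x + 1) c) := by
  rcases Nat.mod_two_eq_zero_or_one x with hx | hx
  · refine ((standard_consecutive_of_even hx (by omega) (fun c hc => ?_) b c).mono
      ha).hasLinearRealization
    by_cases hcx : c % (x + 1) < x
    · have := standard_weave_of_odd_mod hx (show x < x + 1 by omega) x c hc hcx (by omega)
        (by omega)
      convert this using 1; omega
    · exact standard_of_odd_mod_high hx (by omega) (show x < x + 1 by omega) (by omega) c 0 hc
        (by omega)
  · exact ((standard_consecutive_of_odd hx hx1 b c).mono ha).hasLinearRealization

/-! ### Woven paths that can be extended -/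

theorem Config.reflect {x y a b c h e h' e' : ℕ} {P P' : ℕ → ℕ → Prop}
    (H : Config false x y a b c h e P) (hh : h' = a + b + c - h) (he : e' = a + b + c - e)
    (hP : ∀ p q, P' p q → ∃ p' q', P q' p' ∧ p' + p = a + b + c ∧ q' + q = a + b + c) :
    Config false x y a b c h' e' P' := by
  obtain ⟨l, h1, h2, h3, h4, h5⟩ := H
  refine ⟨l.map (a + b + c + 1 - 1 - ·), perm_reflect h1, ?_, ?_, ?_, ?_⟩
  · rw [gaps_reflect (fun p hp => List.mem_range.1 (h1.mem_iff.1 hp)), h2]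
  · rw [List.head?_map, h3, hh]; rfl
  · rw [List.getLast?_map, h4, he]; rfl
  · intro p q hpq
    obtain ⟨p', q', hpq', hp, hq⟩ := hP p q hpq
    have key : ∀ {r s : ℕ}, [r, s] <:+: l →
        [a + b + c - r, a + b + c - s] <:+: l.map (a + b + c + 1 - 1 - ·) := fun h => h.map _
    have ep : p = a + b + c - p' := by omega
    have eq : q = a + b + c - q' := by omega
    rw [ep, eq]
    exact (h5 q' p' hpq').symm.imp (fun h => key h.2) fun h => ⟨rfl, key h⟩

/-- The short columns, ending at the top of the column `y - 1`, then from the top of the column `j`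
through the tall ones. The edge between the tops has length `j + 1`, and every second gap of the
list of tall columns is realized at the bottom, between two vertices less than `y`. -/
theorem exists_ring_list {y c j : ℕ} {t₁ t₂ : List ℕ} (h : 0 < c % y) (hcy : c % y < y)
    (h₁ : (j :: t₁).Perm (List.range (c % y)))
    (h₂ : ((y - 1) :: t₂).Perm (List.range' (c % y) (y - c % y))) :
    ∃ l : List ℕ, l.Perm (List.range (y + c)) ∧
      gaps l = gaps (j :: t₁) + {j + 1} + gaps ((y - 1) :: t₂) + Multiset.replicate c y ∧
      (∀ s p q u, j :: t₁ = s ++ p :: q :: u → s.length % 2 = 0 → [p, q] <:+: l) ∧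
      ∀ p q, p + c % y + 1 = y + c → q = p + (j + 1) → [p, q] <:+: l := by
  obtain ⟨n, r, hr, hcn, hcr⟩ := mod_decomp (y := y) (by omega) c
  rw [hcr] at h hcy h₁ h₂ ⊢
  have hl1 : (j :: t₁).length = r := by rw [h₁.length_eq]; simp
  have hl2 : ((y - 1) :: t₂).length = y - r := by rw [h₂.length_eq]; simp
  have hlast : ((weave y n false ((y - 1) :: t₂)).reverse).getLast? = some (y - 1 + n * y) := by
    rw [List.getLast?_reverse, head?_weave_false]
  refine ⟨(weave y n false ((y - 1) :: t₂)).reverse ++ weave y (n + 1) false (j :: t₁),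
    ?_, ?_, ?_, ?_⟩
  · rw [show y + c = (n + 1) * y + r by rw [add_mul]; omega]
    refine List.Perm.trans ?_ (flatMap_columns_perm hr.le h₁ h₂)
    exact ((((List.reverse_perm _).trans (weave_perm _ _ _ _)).append (weave_perm _ _ _ _))).trans
      List.perm_append_comm
  · rw [gaps_append hlast (head?_weave_false _ _ _ _), gaps_reverse, gaps_weave, gaps_weave, hl1,
      hl2, dist_of_add_eq (d := j + 1) (by rw [add_mul]; omega),
      show c = (y - r) * n + r * (n + 1) by
        obtain ⟨m, rfl⟩ : ∃ m, y = r + m := ⟨y - r, by omega⟩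
        rw [Nat.add_sub_cancel_left, hcn]; ring,
      Multiset.replicate_add]
    abel
  · intro s p q u hs hlen
    rw [hs, weave_append, hlen]
    exact ((pair_infix_weave_bottom y (n + 1) p q u).trans
      (List.infix_append' _ _ [])).trans (by simpa using List.infix_append' _ _ [])
  · intro p q hp hq
    rw [pair_infix_append]
    refine Or.inr (Or.inr ⟨?_, ?_⟩)
    · rw [hlast]; congr 1; omega
    · rw [head?_weave_false, hq]; congr 1; rw [add_mul]; omega

/-- Short columns, then tall columns in an order that begins with `0, 1, …, k`. The pairs
`{0, 1}, {2, 3}, …` up to `k` are neighbours, as are the tops of the columns `y - 1` and `0`. -/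
theorem exists_config_ring {x y c : ℕ} (hx : x % 2 = 0) (hx0 : 0 < x) (hy : 0 < y) (k o₁ o₂ : ℕ)
    (hk : k + o₁ < c % y) (h₁ : x ≤ o₁ + 1 ∨ k + o₁ + 1 = c % y)
    (ho₂ : c % y + o₂ < y) (h₂ : x ≤ o₂ + 1 ∨ c % y + o₂ + 1 = y) :
    ∃ h e, Config false x y (k + o₁ + o₂ + 1) (y - (k + o₁ + o₂ + 2)) c h e
      (fun p q => q = p + 1 ∧ (q ≤ k ∧ p % 2 = 0 ∨ q + c % y = y + c)) := by
  have hcy := Nat.mod_lt c hy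
  obtain ⟨t, ht1, ht2⟩ := exists_arc_up y hx hx0 k (c % y - k) o₁ (by omega) (by omega)
  obtain ⟨u, hu1, hu2⟩ := exists_arc_down y hx hx0 (c % y) (y - c % y - 1) o₂ (by omega) (by omega)
  rw [show c % y + (y - c % y - 1) = y - 1 by omega,
    show y - c % y - 1 + 1 = y - c % y by omega] at hu1
  rw [show c % y + (y - c % y - 1) = y - 1 by omega] at hu2
  have hr : List.range (c % y) = List.range k ++ List.range' k (c % y - k) := by
    rw [List.range_eq_range', List.range_eq_range']
    conv_lhs => rw [show c % y = k + (c % y - k) by omega, ← List.range'_append_1]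
    simp
  obtain ⟨w, hw⟩ : ∃ w, List.range k ++ k :: t = 0 :: w := by
    rcases k with _ | k
    · exact ⟨t, rfl⟩
    · rw [List.range_succ_eq_map]; exact ⟨_, rfl⟩
  have hw1 : (0 :: w).Perm (List.range (c % y)) := by rw [← hw, hr]; exact ht1.append_left _
  have hw2 : gaps (0 :: w) = lengthMultiset (k + o₁) x (c % y - k - 1 - o₁) y 0 := by
    rw [← hw]
    rcases k with _ | k
    · rw [List.range_zero, List.nil_append, ht2, zero_add]
    · have hl : (List.range (k + 1)).getLast? = some k := by simp [List.range_succ]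
      rw [gaps_append hl rfl, ht2, List.range_eq_range', gaps_range', replicate_one_eq x y,
        dist_of_add_eq (d := 1) rfl, singleton_one_eq x y, lengthMultiset_add, lengthMultiset_add]
      congr 1; omega
  obtain ⟨l, hl1, hl2, hl3, hl4⟩ := exists_ring_list (by omega) hcy hw1 hu1
  obtain ⟨h, hh⟩ : ∃ h, l.head? = some h := by
    cases l with
    | nil => have := hl1.length_eq; simp at this; omega
    | cons h l => exact ⟨h, rfl⟩
  refine ⟨h, exists_config_of_list (l := l) ?_ ?_ hh ?_⟩
  · convert hl1 using 2; omega
  · rw [hl2, hw2, hu2, singleton_one_eq x y, replicate_right_eq x y c]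
    simp only [lengthMultiset_add]
    congr 1 <;> omega
  · rintro p q ⟨rfl, ⟨h1, h2⟩ | h1⟩
    · refine Or.inl (hl3 (List.range p) p (p + 1) (List.range' (p + 2) (k - (p + 1)) ++ t) ?_
        (by simpa using h2))
      rw [← hw]
      have e : List.range k ++ [k] =
          List.range p ++ (p :: (p + 1) :: List.range' (p + 2) (k - (p + 1))) := by
        rw [← List.range_succ, List.range_eq_range', List.range_eq_range']
        conv_lhs => rw [show k.succ = p + (k - (p + 1) + 1 + 1) by omega, ← List.range'_append_1]
        simp [List.range'_succ]
      calc _ = (List.range k ++ [k]) ++ t := by simp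
        _ = _ := by rw [e]; simp
    · exact Or.inl (hl4 p (p + 1) (by omega) rfl)

namespace Config

variable {x y : ℕ}

/-- The path `x - 1, x, 0, 1, …, x - 2`. -/
theorem ascendingCut (y : ℕ) (hx : 1 < x) : Config true x y (x - 1) 1 0 (x - 1) (x - 2)
    (fun r s => s = r + 1 ∧ s ≤ x ∧ r ≠ x - 2) := by
  obtain ⟨m, rfl⟩ : ∃ m, x = m + 2 := ⟨x - 2, by omega⟩
  refine ⟨[m + 1, m + 2] ++ List.range' 0 (m + 1), ?_, ?_, ?_, ?_, ?_⟩
  · refine List.perm_append_comm.trans ?_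
    rw [show m + 2 - 1 + 1 + 0 + 1 = (m + 1) + 2 by omega, List.range_add, List.range_eq_range']
    exact List.Perm.refl _
  · rw [gaps_append (p := m + 2) (q := 0) rfl (by simp [List.range'_succ]), gaps_range',
      gaps_cons_cons, dist_of_add_eq (d := 1) rfl, dist_of_add_eq' (d := m + 2) (by omega),
      replicate_one_eq (m + 2) y, singleton_one_eq (m + 2) y, singleton_left_eq (m + 2) y,
      gaps_singleton, add_zero]
    simp only [lengthMultiset_add]
    congr 1; omega
  · rfl
  · rw [List.getLast?_append, List.range'_concat]; simp
  · rintro r s ⟨rfl, h1, h2⟩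
    refine Or.inl ?_
    rw [pair_infix_append]
    by_cases h : r = m + 1
    · exact Or.inl (by rw [h])
    · exact Or.inr (Or.inl (pair_infix_range' (by omega) (by omega)))

/-- A path on new vertices `v, …, v + x + 2 g`, running from `v + x - 1` to `v + x - 2`, replaces
the edge from `v - 1` to `v - 2`. -/
theorem insertCut {a b c h e : ℕ} {P : ℕ → ℕ → Prop} (H : Config false x y (a + 1) b c h e P)
    (hx : x % 2 = 0) (hx0 : 0 < x) (g : ℕ) (hP : P (a + b + c) (a + b + c + 1)) :
    Config false x y (a + (x - 1)) (b + 3 + 2 * g) c h e (fun _ _ => False) := by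
  obtain ⟨m, h1, h2, h3, h4, -⟩ := (ascendingCut y (x := x) (by omega)).pairsX_end 0 1 g (by omega)
    hx0 (by omega) (by omega) (by omega)
  have H' : Config false x y (a + 1) b c h e (fun r s => P s r) :=
    H.toUndirected fun _ _ h => Or.inr h
  have hg : gaps (m.map (a + 1 + b + c + 1 + ·)) = gaps m :=
    gaps_map _ _ fun p _ q _ => by unfold Nat.dist; omega
  refine H'.insert hP (x + 1 + 2 * g) (m.map (a + 1 + b + c + 1 + ·)) ?_ (by omega) ?_
    (fun _ _ h => h.elim)
  · refine List.Perm.map _ ?_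
    convert h1 using 2; omega
  · have l1 : (m.map (a + 1 + b + c + 1 + ·) ++ [a + b + c]).head? =
        some (a + 1 + b + c + 1 + (x - 1)) := by
      rw [List.head?_append, List.head?_map, h3]; rfl
    have l2 : (m.map (a + 1 + b + c + 1 + ·)).getLast? = some (a + 1 + b + c + 1 + (x - 2)) := by
      rw [List.getLast?_map, h4]; rfl
    have := gaps_append (s := [a + b + c + 1]) (p := a + b + c + 1) rfl l1
    rw [List.singleton_append] at this
    rw [this, gaps_append l2 (q := a + b + c) rfl, hg, h2,
      dist_of_add_eq (d := x) (by omega), dist_of_add_eq' (d := x) (by omega),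
      dist_of_add_eq' (d := 1) rfl, singleton_one_eq x y, singleton_left_eq x y, gaps_singleton,
      gaps_singleton, add_zero]
    simp only [zero_add, lengthMultiset_add]
    congr 1 <;> omega

end Config

/-- Fewer than `x + y - 2` ones. If `c % y ≤ x`, or if gluing still works, a woven path takes
`a - (x - 1)` ones and the rest is glued. Otherwise the path is grown from rows,
if there are at least `y` ones, or woven in such a way that it can be extended. -/
theorem hasLinearRealization_of_even_of_large {x y : ℕ} (hx : x % 2 = 0) (hx0 : 0 < x)
    (hxy : 2 * x < y) {a b : ℕ} (c : ℕ) (ha : 3 * x - 2 ≤ a) (hab : x + y - 1 ≤ a + b) :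
    HasLinearRealization (lengthMultiset a x b y c) := by
  by_cases hbig : x + y - 2 ≤ a
  · exact hasLinearRealization_of_even hx hx0 (by omega) b c hbig
  have hr := Nat.mod_lt c (show 0 < y by omega)
  have hjoin : ∀ B ≤ b, Standard x y (a - (x - 1)) B c →
      HasLinearRealization (lengthMultiset a x b y c) := by
    intro B hB H
    have := (standard_of_even y (b - B) hx hx0).join H
    convert this using 2 <;> omega
  by_cases hrx : c % y ≤ x
  · rcases Nat.mod_two_eq_zero_or_one (c % y) with hc | hc
    · exact hjoin _ (by omega) (standard_weave_of_even_mod hx hx0 (by omega) (a - (x - 1)) c hc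
        (by omega) (by omega))
    · exact hjoin _ (by omega) (standard_weave_of_odd_mod hx (by omega) (a - (x - 1)) c hc
        (by omega) (by omega) (by omega))
  by_cases hay : y ≤ a
  · by_cases hexc : y % 2 = 1 → c % y % 2 = 0 → b % 2 = 1 → c % y + x < y
    · exact ((standard_of_even_of_mod_gt hx hx0 hxy b c (by omega) hexc).mono
        hay).hasLinearRealization
    · push Not at hexc
      obtain ⟨h1, h2, h3, h4⟩ := hexc
      exact hjoin _ (by omega) (standard_weave_of_even_mod_of_odd hx hx0 h1 (a - (x - 1)) c h2
        (by omega) (by omega) (by omega))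
  -- the number of missing edges of length `x` is `a + b + 1 - y` for a path with `a` ones
  by_cases hpar : (a + b) % 2 = y % 2
  · -- it is odd: the pair `{0, 1}`, reflected, is replaced by a longer path with `x - 1` ones
    obtain ⟨o₁, o₂, k1, k2, k3, k4, k5⟩ : ∃ o₁ o₂, 1 + o₁ < c % y ∧
        (x ≤ o₁ + 1 ∨ 1 + o₁ + 1 = c % y) ∧ c % y + o₂ < y ∧
        (x ≤ o₂ + 1 ∨ c % y + o₂ + 1 = y) ∧ o₁ + o₂ = a - x := by
      by_cases h : y - c % y - 1 ≤ a - x - (x - 1)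
      · exact ⟨a - x - (y - c % y - 1), y - c % y - 1, by omega, by omega, by omega, by omega,
          by omega⟩
      · exact ⟨x - 1, a - x - (x - 1), by omega, by omega, by omega, by omega, by omega⟩
    obtain ⟨h, e, H⟩ := exists_config_ring hx hx0 (by omega) 1 o₁ o₂ k1 k2 k3 k4
    have H1 := (H.cast (a' := a - x + 1 + 1) (b' := y - 1 - (a - x + 2)) (by omega) (by omega) rfl
      rfl rfl (fun _ _ h => h)).reflect rfl rfl (P' := fun p q => p = y + c - 2 ∧ q = y + c - 1)
      (by rintro p q ⟨rfl, rfl⟩; exact ⟨1, 0, by omega, by omega, by omega⟩)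
    have H2 := H1.insertCut hx hx0 ((a + b - x - y) / 2) (by omega)
    convert H2.hasLinearRealization using 2 <;> omega
  · -- it is even: the pairs `{0, 1}, …, {x - 2, x - 1}`, reflected, are the last `x` vertices
    obtain ⟨o₁, o₂, k1, k2, k3, k4, k5⟩ : ∃ o₁ o₂, x - 1 + o₁ < c % y ∧
        (x ≤ o₁ + 1 ∨ x - 1 + o₁ + 1 = c % y) ∧ c % y + o₂ < y ∧
        (x ≤ o₂ + 1 ∨ c % y + o₂ + 1 = y) ∧ o₁ + o₂ = a - x := by
      by_cases h : c % y - x ≤ x - 1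
      · by_cases h : y - c % y - 1 ≤ a - x - (c % y - x)
        · exact ⟨a - x - (y - c % y - 1), y - c % y - 1, by omega, by omega, by omega, by omega,
            by omega⟩
        · exact ⟨c % y - x, a - x - (c % y - x), by omega, by omega, by omega, by omega, by omega⟩
      · by_cases h : y - c % y - 1 ≤ a - x - (x - 1)
        · exact ⟨a - x - (y - c % y - 1), y - c % y - 1, by omega, by omega, by omega, by omega,
            by omega⟩
        · exact ⟨x - 1, a - x - (x - 1), by omega, by omega, by omega, by omega, by omega⟩
    obtain ⟨h, e, H⟩ := exists_config_ring hx hx0 (by omega) (x - 1) o₁ o₂ k1 k2 k3 k4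
    have H1 := (H.cast (a' := a) (b' := y - 1 - a) (by omega) (by omega) rfl
      rfl rfl (fun _ _ h => h)).reflect rfl rfl (P' := fun p q => q = p + 1 ∧ p + 2 ≤ y + c ∧
        y + c ≤ p + x ∧ (p + y + c) % 2 = 0)
      (by
        rintro p q ⟨rfl, h1, h2, h3⟩
        exact ⟨y + c - 1 - p, y + c - 2 - p, by omega, by omega, by omega⟩)
    have H2 := H1.pairsX_end 0 1 ((a + b + 1 - y) / 2) (by omega) hx0 (by omega) (by omega)
      (by omega)
    convert H2.hasLinearRealization using 2; omega

/-! ### The lengths `1`, `2`, `y` -/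

namespace Config

variable {y a b c h e : ℕ} {P : ℕ → ℕ → Prop}

/-- An edge between the two last vertices lets the path grow by edges of length `2`. -/
theorem growTwo (H : Config false 2 y a b c h e P) (k : ℕ)
    (hP : ∀ p, p + 1 = a + b + c → P p (p + 1)) (habc : 0 < a + b + c) :
    Config false 2 y a (b + k) c h e (fun p q => p + 1 = a + b + k + c ∧ q = p + 1) := by
  induction k with
  | zero => exact H.mono (by rintro p q ⟨h1, rfl⟩; exact hP p (by omega))
  | succ k ih =>
    obtain ⟨p, hp⟩ : ∃ p, p + 1 = a + b + k + c := ⟨a + b + k + c - 1, by omega⟩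
    refine ih.insert (p := p) (q := p + 1) ⟨hp, rfl⟩ 1 [a + (b + k) + c + 1] (List.Perm.refl _)
      (by omega) ?_ ?_
    · rw [List.cons_append, List.nil_append, gaps_cons_cons, gaps_cons_cons, gaps_singleton,
        dist_of_add_eq (p := p) (d := 2) (by omega), dist_of_add_eq' (d := 1) (by omega),
        dist_of_add_eq (p := p) (d := 1) rfl, singleton_one_eq 2 y, singleton_left_eq 2 y, add_zero]
      simp only [lengthMultiset_add]
      congr 1
    · rintro r s ⟨h1, rfl⟩
      have e1 : r = p + 1 := by omega
      have e2 : a + (b + k) + c + 1 = r + 1 := by omega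
      rw [e1] at e2 ⊢
      rw [e2]
      exact Or.inr (Or.inr ⟨rfl, [p], [], by simp⟩)

end Config

/-- For at most `y - 1` ones: a woven path with `a` ones and `y - 1 - a` edges of length `2` that
contains the edge between the last two or between the first two vertices. -/
theorem hasLinearRealization_two {y a b : ℕ} (c : ℕ) (hy : 5 ≤ y) (ha : 3 ≤ a)
    (hab : y - 1 ≤ a + b) : HasLinearRealization (lengthMultiset a 2 b y c) := by
  by_cases hay : y ≤ a
  · exact hasLinearRealization_of_even rfl (by omega) (by omega) b c (by omega)
  have hr := Nat.mod_lt c (show 0 < y by omega)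
  -- it suffices to have a path with the fewest edges of length `2`, extensible at one end
  have top : ∀ {h e : ℕ} {P : ℕ → ℕ → Prop}, Config false 2 y a (y - 1 - a) c h e P →
      (∀ p, p + 2 = y + c → P p (p + 1)) → HasLinearRealization (lengthMultiset a 2 b y c) := by
    intro h e P H hP
    have := (H.growTwo (a + b + 1 - y) (fun p hp => hP p (by omega))
      (by omega)).hasLinearRealization
    convert this using 2; omega
  have bottom : ∀ {h e : ℕ} {P : ℕ → ℕ → Prop}, Config false 2 y a (y - 1 - a) c h e P →
      P 0 1 → HasLinearRealization (lengthMultiset a 2 b y c) := by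
    intro h e P H hP
    refine top (H.reflect rfl rfl (P' := fun p q => p + 2 = y + c ∧ q = p + 1) ?_)
      (fun p hp => ⟨hp, rfl⟩)
    rintro p q ⟨h1, rfl⟩
    exact ⟨1, 0, hP, by omega, by omega⟩
  by_cases h0 : c % y = 0
  · by_cases hb : a + b + 1 = y
    · obtain ⟨e, H⟩ := exists_config_weave_of_even_mod (x := 2) (y := y) rfl (by omega) (by omega)
        a c (by omega) (by omega) (by omega)
      convert H.hasLinearRealization using 2; omega
    · have H := standard_weave_of_even_mod (x := 2) (y := y) rfl (by omega) (by omega)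
        (a - 1) c (by omega) (by omega) (by omega)
      have := (standard_of_even y (b - (y - a)) (x := 2) rfl (by omega)).join H
      convert this using 2 <;> omega
  by_cases h1 : c % y = 1
  · obtain ⟨h, e, H⟩ := exists_config_ring (x := 2) (y := y) (c := c) rfl (by omega) (by omega)
      0 0 (a - 1) (by omega) (by omega) (by omega) (by omega)
    exact top (H.cast (by omega) (by omega) rfl rfl rfl (fun _ _ h => h))
      (fun p hp => ⟨rfl, Or.inr (by omega)⟩)
  by_cases h2 : c % y = 2
  · obtain ⟨e, H⟩ := exists_config_weave_of_even_mod (x := 2) (y := y) rfl (by omega) (by omega)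
      a c (by omega) (by omega) (by omega)
    exact top H (fun p hp => by omega)
  by_cases h3 : 4 ≤ a ∨ c % y + 1 = y
  · obtain ⟨o₁, o₂, k1, k2, k3, k4, k5⟩ : ∃ o₁ o₂, 1 + o₁ < c % y ∧
        (2 ≤ o₁ + 1 ∨ 1 + o₁ + 1 = c % y) ∧ c % y + o₂ < y ∧
        (2 ≤ o₂ + 1 ∨ c % y + o₂ + 1 = y) ∧ o₁ + o₂ + 2 = a := by
      by_cases h : y - c % y - 1 ≤ a - 3
      · exact ⟨a - 2 - (y - c % y - 1), y - c % y - 1, by omega, by omega, by omega, by omega,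
          by omega⟩
      · exact ⟨1, a - 3, by omega, by omega, by omega, by omega, by omega⟩
    obtain ⟨h, e, H⟩ := exists_config_ring (x := 2) (y := y) rfl (by omega) (by omega)
      1 o₁ o₂ k1 k2 k3 k4
    exact bottom (H.cast (by omega) (by omega) rfl rfl rfl (fun _ _ h => h))
      ⟨rfl, Or.inl ⟨le_refl _, rfl⟩⟩
  obtain rfl : a = 3 := by omega
  by_cases h4 : y = 5
  · -- `y = 5`, `c % y = 3`: the columns in the order `3, 4, 2, 1, 0`
    subst h4
    obtain ⟨n, r, hr, hcn, hcr⟩ := mod_decomp (y := 5) (by omega) c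
    obtain rfl : r = 3 := by omega
    have hp := ((weave_perm 5 n true [3, 4]).append (weave_perm 5 (n + 1) true [2, 1, 0])).trans
      (List.perm_append_comm.trans (flatMap_columns_perm (r := 3) (by omega)
        (List.reverse_perm [0, 1, 2]) (List.Perm.refl _)))
    have hh : (weave 5 n true [3, 4] ++ weave 5 (n + 1) true [2, 1, 0]).head? = some 3 := by
      rw [List.head?_append, head?_weave_true]; rfl
    have hl : (weave 5 n true [3, 4]).getLast? = some 4 :=
      getLast?_weave_bottom 5 n 4 true [3] rfl
    obtain ⟨e, H⟩ := exists_config_of_list (x := 2) (y := 5) (a := 3) (b := 1) (c := c)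
      (P := fun p q => p = 0 ∧ q = 1) (by convert hp using 2; omega) (by
        rw [gaps_append hl (head?_weave_true _ _ _ _),
          gaps_weave, gaps_weave]
        simp only [gaps_cons_cons, gaps_singleton, List.length_cons, List.length_nil,
          dist_of_add_eq (show 3 + 1 = 4 from rfl), dist_of_add_eq' (show 2 + 2 = 4 from rfl),
          dist_of_add_eq' (show 1 + 1 = 2 from rfl), dist_of_add_eq' (show 0 + 1 = 1 from rfl),
          singleton_one_eq 2 5, singleton_left_eq 2 5, replicate_right_eq 2 5, lengthMultiset_add,
          add_zero]
        congr 1; omega) hh (by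
        rintro p q ⟨rfl, rfl⟩
        refine Or.inr ⟨rfl, List.IsInfix.trans
          ((pair_infix_weave_bottom 5 (n + 1) 1 0 []).trans ?_) (List.suffix_append _ _).isInfix⟩
        exact (List.suffix_append (column 5 (n + 1) 2) _).isInfix)
    exact bottom H ⟨rfl, rfl⟩
  -- the short columns, then the tall ones in the order `1, 0, 2, …`; the edge at the top leading to
  -- the column `1` and the one from `0` to `2` have length `2`
  obtain ⟨o₁, o₂, k1, k2, k3, k4, k5⟩ : ∃ o₁ o₂, 2 + o₁ < c % y ∧
      (2 ≤ o₁ + 1 ∨ o₁ + 1 = c % y - 2) ∧ c % y + o₂ < y ∧ 2 ≤ o₂ + 1 ∧ o₁ + o₂ = 2 := by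
    by_cases h : c % y = 3
    · exact ⟨0, 2, by omega, by omega, by omega, by omega, by omega⟩
    · exact ⟨1, 1, by omega, by omega, by omega, by omega, by omega⟩
  obtain ⟨t, ht1, ht2⟩ := exists_arc_up (x := 2) y rfl (by omega) 2 (c % y - 2) o₁ (by omega) k2
  obtain ⟨u, hu1, hu2⟩ := exists_arc_down (x := 2) y rfl (by omega) (c % y) (y - c % y - 1) o₂
    (by omega) (by omega)
  rw [show c % y + (y - c % y - 1) = y - 1 by omega,
    show y - c % y - 1 + 1 = y - c % y by omega] at hu1
  rw [show c % y + (y - c % y - 1) = y - 1 by omega] at hu2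
  have hw1 : (1 :: 0 :: 2 :: t).Perm (List.range (c % y)) := by
    obtain ⟨m, hm⟩ : ∃ m, c % y = m + 1 + 1 := ⟨c % y - 2, by omega⟩
    rw [hm, List.range_eq_range', List.range'_succ, List.range'_succ]
    rw [hm] at ht1
    exact (List.Perm.swap _ _ _).trans ((ht1.cons 1).cons 0)
  obtain ⟨l, hl1, hl2, hl3, -⟩ := exists_ring_list (by omega) hr hw1 hu1
  obtain ⟨h, hh⟩ : ∃ h, l.head? = some h := by
    cases l with
    | nil => have := hl1.length_eq; simp at this; omega
    | cons h l => exact ⟨h, rfl⟩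
  obtain ⟨e, H⟩ := exists_config_of_list (x := 2) (y := y) (a := 3) (b := y - 1 - 3) (c := c)
    (P := fun p q => p = 0 ∧ q = 1) (by convert hl1 using 2; omega) (by
      rw [hl2, hu2, gaps_cons_cons, gaps_cons_cons, ht2, dist_of_add_eq' (d := 1) rfl,
        dist_of_add_eq (d := 2) rfl, singleton_one_eq 2 y, singleton_left_eq 2 y,
        replicate_right_eq 2 y c]
      simp only [lengthMultiset_add]
      congr 1 <;> omega) hh (by
      rintro p q ⟨rfl, rfl⟩
      exact Or.inr ⟨rfl, hl3 [] 1 0 (2 :: t) rfl rfl⟩)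
  exact bottom H ⟨rfl, rfl⟩

theorem mainTheorem1 (x y a b c : ℕ) (hx : 1 < x) (hxy : x < y) (hab : y - 1 ≤ a + b) :
    (Even x → x + y - 2 ≤ a → HasLinearRealization (lengthMultiset a x b y c)) ∧
    (Odd x → (Even y ∧ x + y - 1 ≤ a ∨ Odd y ∧ x + y ≤ a) →
      HasLinearRealization (lengthMultiset a x b y c)) ∧
    (y = x + 1 → x + 1 ≤ a → HasLinearRealization (lengthMultiset a x b y c)) ∧
    (Even x → 2 * x + 1 ≤ y → 3 * x - 2 ≤ a → x + y - 1 ≤ a + b →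
      HasLinearRealization (lengthMultiset a x b y c)) ∧
    (x = 2 → 5 ≤ y → 3 ≤ a → HasLinearRealization (lengthMultiset a x b y c)) := by
  simp only [Nat.even_iff, Nat.odd_iff]
  refine ⟨fun h ha => hasLinearRealization_of_even h (by omega) hxy b c ha,
    fun h ha => hasLinearRealization_of_odd h hx hxy b c ha, ?_,
    fun h h1 h2 h3 => hasLinearRealization_of_even_of_large h (by omega) (by omega) c h2 h3, ?_⟩
  · rintro rfl ha
    exact hasLinearRealization_consecutive hx b c ha
  · rintro rfl hy ha
    exact hasLinearRealization_two c hy ha hab
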